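/- Let $k$ be a field and $x,y$ indeterminates over $k$. Let $\sigma=\sum_{i\ge1}a_ix^i\in xk[[x]]$ and $\tau=\sum_{i\ge1}b_iy^i\in yk[[y]]$ be power series that are transcendental over $k(x)$ and over $k(y)$, respectively. For $n\ge 0$ let $\sigma_n=\sum_{i>n}a_ix^{i-n}$ and $\tau_n=\sum_{i>n}b_iy^{i-n}$ be the $n$-th endpieces. Inside $k[[x,y]]$ and its field of fractions put $$U_n=k[x,y,\sigma_n,\tau_n],\quad U=\bigcup_n U_n,\quad B_n=k[x,y,\sigma_n,\tau_n]_{(x,y,\sigma_n,\tau_n)},\quad B=\bigcup_n B_n,\quad A=k(x,y,\sigma,\tau)\cap k[[x,y]]$$ (the $U_n$ and the $B_n$ form increasing chains). Then $A$ is a two-dimensional regular local domain that birationally dominates $B$ (that is, $A$ and $B$ are local, $B\subseteq A$, they have the same field of fractions, and the maximal ideal of $A$ contracts to that of $B$); $A$ has maximal ideal $(x,y)A$ and completion $\widehat A=k[[x,y]]$. Moreover: 1. $U$ and $B$ are unique factorization domains. 2. $B$ is a local Krull domain with maximal ideal $\mathbf n=(x,y)B$. 3. The dimension of $B$ is either $2$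 or $3$, depending on the choice of $\sigma$ and $\tau$: for every field $k$, both values occur for suitable $\sigma,\tau$ as above. 4. $B$ is Hausdorff in the $\mathbf n$-adic topology. 5. The $\mathbf n$-adic completion $\widehat B$ of $B$ is canonically isomorphic to $k[[x,y]]$ (that is, as a $B$-algebra). 6. The following are equivalent: (a) $B=A$; (b) $B$ is a two-dimensional regular local domain; (c) $B$ is Noetherian; (d) every finitely generated ideal of $B$ is closed in the $\mathbf n$-adic topology on $B$; (e) every principal ideal of $B$ is closed in the $\mathbf n$-adic topology on $B$. -/

import Mathlib

noncomputable section

namespace TwoVar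

/-- An integral domain `R` is a Krull domain: inside its field of fractions it is the intersection
of a family of discrete valuation rings such that every nonzero element of the field is a unit in
all but finitely many members of the family. -/
def IsKrullDomain (R : Type*) [CommRing R] [IsDomain R] : Prop :=
  ∃ 𝒱 : Set (ValuationSubring (FractionRing R)),
    (∀ V ∈ 𝒱, IsDiscreteValuationRing V) ∧
    (∀ a : FractionRing R, a ∈ (algebraMap R (FractionRing R)).range ↔ ∀ V ∈ 𝒱, a ∈ V) ∧
    (∀ a : FractionRing R, a ≠ 0 → {V ∈ 𝒱 | V.valuation a ≠ 1}.Finite)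

/-- The ring `k[[x, y]]`; the variables `x` and `y` are `X 0` and `X 1`. -/
abbrev PS (k : Type*) [Field k] : Type _ := MvPowerSeries (Fin 2) k

instance PS_isDomain (k : Type*) [Field k] : IsDomain (PS k) := NoZeroDivisors.to_isDomain _

/-- The `n`-th endpiece `∑_{i > n} a_i t ^ (i - n)` of `f = ∑ a_i t ^ i`. -/
def endpiece {k : Type*} [Field k] (f : PowerSeries k) (n : ℕ) : PowerSeries k :=
  PowerSeries.mk fun j => if j = 0 then 0 else PowerSeries.coeff (n + j) f

/-- A power series in one variable, regarded as an element of `k[[x, y]]` by substituting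
the variable `x` (for `i = 0`) or `y` (for `i = 1`). -/
def inVar {k : Type*} [Field k] (i : Fin 2) (f : PowerSeries k) : PS k :=
  f.subst (MvPowerSeries.X i : PS k)

section

open scoped RatFunc

/-- `σ` and `τ` have zero constant term and are transcendental over the field of rational functions
in one variable, inside the field of Laurent series in that variable. -/
structure IsTranscendentalPair {k : Type*} [Field k] (σ τ : PowerSeries k) : Prop where
  constantCoeff_left : PowerSeries.constantCoeff σ = 0
  constantCoeff_right : PowerSeries.constantCoeff τ = 0
  transcendental_left : Transcendental (RatFunc k) (σ : LaurentSeries k)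
  transcendental_right : Transcendental (RatFunc k) (τ : LaurentSeries k)

end

/-- The set `{x, y, σ_n, τ_n}` in `k[[x, y]]`. -/
def gens {k : Type*} [Field k] (σ τ : PowerSeries k) (n : ℕ) : Set (PS k) :=
  {MvPowerSeries.X 0, MvPowerSeries.X 1, inVar 0 (endpiece σ n), inVar 1 (endpiece τ n)}

/-- `U_n = k[x, y, σ_n, τ_n]`. -/
def Un {k : Type*} [Field k] (σ τ : PowerSeries k) (n : ℕ) : Subalgebra k (PS k) :=
  Algebra.adjoin k (gens σ τ n)

/-- The ideal `(x, y, σ_n, τ_n)` of `U_n`. -/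
def Pn {k : Type*} [Field k] (σ τ : PowerSeries k) (n : ℕ) : Ideal (Un σ τ n) :=
  Ideal.span {u | (u : PS k) ∈ gens σ τ n}

theorem constantCoeff_gens {k : Type*} [Field k] (σ τ : PowerSeries k) (n : ℕ) {f : PS k}
    (hf : f ∈ gens σ τ n) : MvPowerSeries.constantCoeff f = 0 := by
  have h0 : ∀ g : PowerSeries k, PowerSeries.constantCoeff (endpiece g n) = 0 := fun g => by
    simp [endpiece, ← PowerSeries.coeff_zero_eq_constantCoeff_apply]
  rcases hf with rfl | rfl | rfl | rfl
  · simp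
  · simp
  · exact PowerSeries.constantCoeff_subst_eq_zero (by simp) _ (h0 σ)
  · exact PowerSeries.constantCoeff_subst_eq_zero (by simp) _ (h0 τ)

theorem mem_Pn_iff {k : Type*} [Field k] (σ τ : PowerSeries k) (n : ℕ) (u : Un σ τ n) :
    u ∈ Pn σ τ n ↔ MvPowerSeries.constantCoeff (u : PS k) = 0 := by
  constructor
  · intro hu
    have hle : Pn σ τ n ≤
        RingHom.ker ((MvPowerSeries.constantCoeff (σ := Fin 2) (R := k)).comp
          (Un σ τ n).val.toRingHom) :=
      Ideal.span_le.2 fun v hv => constantCoeff_gens σ τ n hv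
    exact hle hu
  · intro hu
    have key : ∀ f (hf : f ∈ Algebra.adjoin k (gens σ τ n)),
        (⟨f, hf⟩ : Un σ τ n) - algebraMap k _ (MvPowerSeries.constantCoeff f) ∈ Pn σ τ n := by
      intro f hf
      induction hf using Algebra.adjoin_induction with
      | mem f hf =>
        rw [constantCoeff_gens σ τ n hf, map_zero, sub_zero]
        exact Ideal.subset_span hf
      | algebraMap r =>
        have : (⟨algebraMap k (PS k) r, Subalgebra.algebraMap_mem _ r⟩ : Un σ τ n)
            - algebraMap k _ (MvPowerSeries.constantCoeff (algebraMap k (PS k) r)) = 0 := by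
          apply Subtype.ext
          simp [MvPowerSeries.algebraMap_apply]
        exact this ▸ (Pn σ τ n).zero_mem
      | add f g hf hg h1 h2 =>
        convert (Pn σ τ n).add_mem h1 h2 using 1
        apply Subtype.ext
        simp only [map_add, AddSubgroupClass.coe_sub, Subalgebra.coe_add,
          Subalgebra.coe_algebraMap]
        ring
      | mul f g hf hg h1 h2 =>
        convert (Pn σ τ n).add_mem ((Pn σ τ n).mul_mem_left ⟨f, hf⟩ h2)
          ((Pn σ τ n).mul_mem_left
            (algebraMap k _ (MvPowerSeries.constantCoeff g)) h1) using 1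
        apply Subtype.ext
        simp only [map_mul, AddSubgroupClass.coe_sub, Subalgebra.coe_add, Subalgebra.coe_mul,
          Subalgebra.coe_algebraMap]
        ring
    have := key u u.2
    rwa [hu, map_zero, sub_zero] at this

instance Pn_isPrime {k : Type*} [Field k] (σ τ : PowerSeries k) (n : ℕ) :
    (Pn σ τ n).IsPrime where
  ne_top' := fun h => by
    have : (1 : Un σ τ n) ∈ Pn σ τ n := h ▸ Submodule.mem_top
    simp [mem_Pn_iff] at this
  mem_or_mem' := fun {u v} h => by
    simpa [mem_Pn_iff] using h

/-- For a subring `U` of `k[[x, y]]` and a prime ideal `P` of `U`, the power series that are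
fractions `a / s` with `a ∈ U` and `s ∈ U \ P`. If the elements of `U \ P` are units
of `k[[x, y]]`, this is the localization `U_P`. -/
def localizationIn {k : Type*} [Field k] (U : Subalgebra k (PS k)) (P : Ideal U) [P.IsPrime] :
    Subalgebra k (PS k) where
  carrier := {f | ∃ a s : U, s ∉ P ∧ (s : PS k) * f = a}
  mul_mem' := by
    rintro f g ⟨a, s, hs, h⟩ ⟨b, t, ht, h'⟩
    refine ⟨a * b, s * t, P.primeCompl.mul_mem hs ht, ?_⟩
    simp only [Subalgebra.coe_mul, ← h, ← h']
    ring
  add_mem' := by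
    rintro f g ⟨a, s, hs, h⟩ ⟨b, t, ht, h'⟩
    refine ⟨t * a + s * b, s * t, P.primeCompl.mul_mem hs ht, ?_⟩
    simp only [Subalgebra.coe_mul, Subalgebra.coe_add, ← h, ← h']
    ring
  algebraMap_mem' := fun r =>
    ⟨algebraMap k U r, 1, P.primeCompl.one_mem, by simp⟩

/-- `B_n = k[x, y, σ_n, τ_n]_{(x, y, σ_n, τ_n)}`. -/
def Bn {k : Type*} [Field k] (σ τ : PowerSeries k) (n : ℕ) : Subalgebra k (PS k) :=
  localizationIn (Un σ τ n) (Pn σ τ n)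

theorem isUnit_of_notMem_Pn {k : Type*} [Field k] (σ τ : PowerSeries k) (n : ℕ)
    (s : Un σ τ n) (hs : s ∉ Pn σ τ n) : IsUnit (s : PS k) := by
  rw [mem_Pn_iff] at hs
  exact MvPowerSeries.isUnit_iff_constantCoeff.2 (isUnit_iff_ne_zero.2 hs)

theorem Un_le_Bn {k : Type*} [Field k] (σ τ : PowerSeries k) (n : ℕ) : Un σ τ n ≤ Bn σ τ n :=
  fun f hf => ⟨⟨f, hf⟩, 1, (Pn σ τ n).primeCompl.one_mem, by simp⟩

theorem endpiece_succ {k : Type*} [Field k] (f : PowerSeries k) (n : ℕ) :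
    endpiece f n = PowerSeries.C (PowerSeries.coeff (n + 1) f) * PowerSeries.X
      + PowerSeries.X * endpiece f (n + 1) := by
  ext j
  rcases j with _ | _ | j
  · simp [endpiece]
  · simp [endpiece]
  · simp [endpiece, PowerSeries.coeff_succ_X_mul,
      show n + (j + 1 + 1) = n + 1 + (j + 1) by ring]

theorem inVar_endpiece_succ {k : Type*} [Field k] (i : Fin 2) (f : PowerSeries k) (n : ℕ) :
    inVar i (endpiece f n) =
      algebraMap k (PS k) (PowerSeries.coeff (n + 1) f) * MvPowerSeries.X i
        + MvPowerSeries.X i * inVar i (endpiece f (n + 1)) := by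
  have hs : PowerSeries.HasSubst (MvPowerSeries.X i : PS k) := PowerSeries.HasSubst.X i
  rw [inVar, endpiece_succ, PowerSeries.subst_add hs, PowerSeries.subst_mul hs,
    PowerSeries.subst_mul hs, PowerSeries.subst_X hs, PowerSeries.subst_C]
  rfl

theorem Un_mono {k : Type*} [Field k] (σ τ : PowerSeries k) : Monotone (Un σ τ) := by
  refine monotone_nat_of_le_succ fun n => Algebra.adjoin_le ?_
  have hx : (MvPowerSeries.X 0 : PS k) ∈ Un σ τ (n + 1) :=
    Algebra.subset_adjoin (by simp [gens])
  have hy : (MvPowerSeries.X 1 : PS k) ∈ Un σ τ (n + 1) :=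
    Algebra.subset_adjoin (by simp [gens])
  have hσ : inVar 0 (endpiece σ (n + 1)) ∈ Un σ τ (n + 1) :=
    Algebra.subset_adjoin (by simp [gens])
  have hτ : inVar 1 (endpiece τ (n + 1)) ∈ Un σ τ (n + 1) :=
    Algebra.subset_adjoin (by simp [gens])
  rintro f (rfl | rfl | rfl | rfl)
  · exact hx
  · exact hy
  · rw [inVar_endpiece_succ]
    exact add_mem (mul_mem (Subalgebra.algebraMap_mem _ _) hx) (mul_mem hx hσ)
  · rw [inVar_endpiece_succ]
    exact add_mem (mul_mem (Subalgebra.algebraMap_mem _ _) hy) (mul_mem hy hτ)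

theorem Bn_mono {k : Type*} [Field k] (σ τ : PowerSeries k) : Monotone (Bn σ τ) := by
  rintro m n h f ⟨a, s, hs, e⟩
  refine ⟨⟨a, Un_mono σ τ h a.2⟩, ⟨s, Un_mono σ τ h s.2⟩, ?_, e⟩
  rw [mem_Pn_iff] at hs ⊢
  exact hs

/-- `U = ⋃ U_n`, the union of an increasing chain (`Un_mono`). -/
def U {k : Type*} [Field k] (σ τ : PowerSeries k) : Subalgebra k (PS k) := ⨆ n, Un σ τ n

/-- `B = ⋃ B_n`, the union of an increasing chain (`Bn_mono`). -/
def B {k : Type*} [Field k] (σ τ : PowerSeries k) : Subalgebra k (PS k) := ⨆ n, Bn σ τ n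

theorem mem_U_iff {k : Type*} [Field k] (σ τ : PowerSeries k) (f : PS k) :
    f ∈ U σ τ ↔ ∃ n, 1 ≤ n ∧ f ∈ Un σ τ n := by
  rw [← SetLike.mem_coe, U, Subalgebra.coe_iSup_of_directed (Un_mono σ τ).directed_le,
    Set.mem_iUnion]
  exact ⟨fun ⟨n, h⟩ => ⟨n + 1, by omega, Un_mono σ τ n.le_succ h⟩, fun ⟨n, _, h⟩ => ⟨n, h⟩⟩

theorem mem_B_iff {k : Type*} [Field k] (σ τ : PowerSeries k) (f : PS k) :
    f ∈ B σ τ ↔ ∃ n, 1 ≤ n ∧ f ∈ Bn σ τ n := by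
  rw [← SetLike.mem_coe, B, Subalgebra.coe_iSup_of_directed (Bn_mono σ τ).directed_le,
    Set.mem_iUnion]
  exact ⟨fun ⟨n, h⟩ => ⟨n + 1, by omega, Bn_mono σ τ n.le_succ h⟩, fun ⟨n, _, h⟩ => ⟨n, h⟩⟩

/-- The subfield `k(x, y, σ, τ)` of the field of fractions of `k[[x, y]]`. -/
def fieldL {k : Type*} [Field k] (σ τ : PowerSeries k) :
    IntermediateField k (FractionRing (PS k)) :=
  IntermediateField.adjoin k (algebraMap (PS k) (FractionRing (PS k)) ''
    {MvPowerSeries.X 0, MvPowerSeries.X 1, inVar 0 σ, inVar 1 τ})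

/-- `A = k(x, y, σ, τ) ∩ k[[x, y]]`, as a subalgebra of `k[[x, y]]`. -/
def A {k : Type*} [Field k] (σ τ : PowerSeries k) : Subalgebra k (PS k) :=
  (fieldL σ τ).toSubalgebra.comap (IsScalarTower.toAlgHom k (PS k) (FractionRing (PS k)))

theorem X_mem_B {k : Type*} [Field k] (σ τ : PowerSeries k) (i : Fin 2) :
    (MvPowerSeries.X i : PS k) ∈ B σ τ := by
  refine (mem_B_iff σ τ _).2 ⟨1, le_rfl, Un_le_Bn σ τ 1 (Algebra.subset_adjoin ?_)⟩
  fin_cases i <;> simp [gens]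

theorem X_mem_A {k : Type*} [Field k] (σ τ : PowerSeries k) (i : Fin 2) :
    (MvPowerSeries.X i : PS k) ∈ A σ τ := by
  refine IntermediateField.subset_adjoin _ _ (Set.mem_image_of_mem _ ?_)
  fin_cases i <;> simp

/-- The ideal `(x, y)A` of `A`. -/
def idealA {k : Type*} [Field k] (σ τ : PowerSeries k) : Ideal (A σ τ) :=
  Ideal.span {⟨MvPowerSeries.X 0, X_mem_A σ τ 0⟩, ⟨MvPowerSeries.X 1, X_mem_A σ τ 1⟩}

/-- The ideal `(x, y)B` of `B`. -/
def idealB {k : Type*} [Field k] (σ τ : PowerSeries k) : Ideal (B σ τ) :=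
  Ideal.span {⟨MvPowerSeries.X 0, X_mem_B σ τ 0⟩, ⟨MvPowerSeries.X 1, X_mem_B σ τ 1⟩}

/-- For subrings `S ≤ T` of `k[[x, y]]`, both local: `T` birationally dominates `S`. They have the
same field of fractions (each element of `T` is a fraction of elements of `S`), and the maximal
ideal of `T` lies over that of `S` (the inclusion is a local homomorphism). -/
structure BirationallyDominates {k : Type*} [Field k] (T S : Subalgebra k (PS k)) : Prop where
  le : S ≤ T
  isLocalRing_left : IsLocalRing T
  isLocalRing_right : IsLocalRing S
  exists_fraction : ∀ f ∈ T, ∃ a ∈ S, ∃ b ∈ S, b ≠ 0 ∧ b * f = a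
  isLocalHom : IsLocalHom (Subalgebra.inclusion le)

end TwoVar

end

/-!
# Endpiece constructions in two variables

Almost everything follows from one property of a subalgebra `S` of `k[[x, y]]`, here called being
*edge-closed* (`IsEdgeClosed`): `S` contains `x` and `y`, an element of `S` that is divisible by a
variable in `k[[x, y]]` is divisible by it in `S`, and with `f` also the restrictions `f(x, 0)`
and `f(0, y)` belong to `S`. The ring `U` has this property because the `n`-th endpiece of `σ` is
the product of `x` and an element of `U`, and the property passes to the localization `B` and to
`A`. In an edge-closed `S` the ideal `(x, y) ^ n` consists of the elements of order at least `n`,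
so that the completion of `S` is `k[[x, y]]` and `S` is Hausdorff. If moreover `S` contains the
inverses of its elements with nonzero constant term, then `S` is local with maximal ideal
`(x, y)`, and the only primes that contain a variable are `(x)`, `(y)` and `(x, y)`.

* `A` is Noetherian, hence regular of dimension two. Let `P` be a prime with `x ∉ P`, and choose
  `f ∈ P` with `f(0, y)` of minimal order. Then `f` divides every element of `P` modulo `x P`,
  hence in `k[[x, y]]`, hence in `A` (`IsLocalEdgeClosed.isNoetherianRing`).
* After multiplication by a power of `x * y`, the elements of `U` are polynomials in the
  algebraically independent `x, σ, y, τ`. Hence `U` and `B` are factorial, by a form of Nagata's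
  criterion (`uniqueFactorizationMonoid_of_prime_of_prime`), and factorial domains are Krull
  domains.
* A prime `P` of `B` that contains neither `x` nor `y` contains no nonzero polynomial in `x` and
  `σ`, since such a polynomial is a power of `x` times a unit. As the ring `k[x, σ][y, τ]` needs
  only two variables over `k[x, σ]`, the height of `P` is at most two, and the dimension of `B` at
  most three (`ringKrullDim_B_le_three`).
* The closure of a principal ideal `b B` is `B ∩ b k[[x, y]]`. If all of them are closed, then a
  fraction `a / b` in `A` lies in `B`, which closes the circle of equivalences (`tfae_B_eq_A`).

Both dimensions occur. If `τ` is the same series as `σ`, then the power series that vanish for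
`x = y` form a prime ideal of `B`. It contains `σ(x) - σ(y)`, which is not a multiple of `x - y`
in `B`, so that it is larger than `(x - y)` and the dimension is three
(`ringKrullDim_B_self_eq_three`). For dimension two, `σ` is arbitrary
and `τ` is a lacunary series whose gaps grow fast compared with the orders of vanishing of
polynomials in `x` and `σ`. A prime `P` of height at least two that contains no variable would
contain nonzero polynomials `F(y)` and `G(τ)` with coefficients in `k[x, σ]`. Replace `τ` in `G`
by a partial sum, which is a polynomial in `y`, and eliminate `y` by a resultant. The result is a
polynomial in `x` and `σ` of bounded degree, so its order in `x` is small; but it lies in `P` up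
to a high power of `y`, which modulo `P` is a multiple of a high power of `x`
(`height_le_one_of_lacunary`).
-/

noncomputable section

namespace TwoVar

/-! ### Power series in two variables -/

section

variable {k : Type*} [Field k]

theorem fin_two_eq_of_ne {i j l : Fin 2} (hij : i ≠ j) (h : l ≠ i) : l = j := by omega

theorem coeff_inVar (i : Fin 2) (f : PowerSeries k) (d : Fin 2 →₀ ℕ) :
    MvPowerSeries.coeff d (inVar i f) =
      if Finsupp.single i (d i) = d then PowerSeries.coeff (d i) f else 0 := by
  rw [inVar, PowerSeries.coeff_subst_single]
  simp only [eq_comm]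

/-- The substitution `f ↦ f(X i)` as a homomorphism of algebras. -/
def inVarHom (i : Fin 2) : PowerSeries k →ₐ[k] PS k :=
  PowerSeries.substAlgHom (PowerSeries.HasSubst.X i)

theorem inVarHom_apply (i : Fin 2) (f : PowerSeries k) : inVarHom i f = inVar i f := by
  rw [inVarHom, PowerSeries.coe_substAlgHom, inVar]

theorem inVar_mul (i : Fin 2) (f g : PowerSeries k) : inVar i (f * g) = inVar i f * inVar i g := by
  simp only [← inVarHom_apply, map_mul]

theorem inVar_add (i : Fin 2) (f g : PowerSeries k) : inVar i (f + g) = inVar i f + inVar i g := by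
  simp only [← inVarHom_apply, map_add]

theorem inVar_zero (i : Fin 2) : inVar i (0 : PowerSeries k) = 0 := by
  simp only [← inVarHom_apply, map_zero]

theorem inVar_X (i : Fin 2) : inVar i (PowerSeries.X : PowerSeries k) = MvPowerSeries.X i :=
  PowerSeries.subst_X (PowerSeries.HasSubst.X i)

theorem inVar_algebraMap (i : Fin 2) (r : k) :
    inVar i (algebraMap k (PowerSeries k) r) = algebraMap k (PS k) r := by
  rw [← inVarHom_apply, AlgHom.commutes]

theorem coeff_single_inVar_self (i : Fin 2) (f : PowerSeries k) (n : ℕ) :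
    MvPowerSeries.coeff (Finsupp.single i n) (inVar i f) = PowerSeries.coeff n f := by
  simp [coeff_inVar]

theorem inVar_injective (i : Fin 2) : Function.Injective (inVar (k := k) i) := fun f g h => by
  ext n
  rw [← coeff_single_inVar_self i, h, coeff_single_inVar_self]

/-- Restriction of a power series in two variables to the `j`-th coordinate axis: the other
variable is replaced by `0`. -/
def edge (j : Fin 2) : PS k →+* PowerSeries k where
  toFun f := PowerSeries.mk fun n => MvPowerSeries.coeff (Finsupp.single j n) f
  map_one' := by
    ext n
    simp [MvPowerSeries.coeff_one, PowerSeries.coeff_one]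
  map_zero' := by
    ext n
    simp
  map_add' f g := by
    ext n
    simp
  map_mul' f g := by
    ext n
    simp [MvPowerSeries.coeff_mul, PowerSeries.coeff_mul, Finsupp.antidiagonal_single]

theorem coeff_edge (j : Fin 2) (f : PS k) (n : ℕ) :
    PowerSeries.coeff n (edge j f) = MvPowerSeries.coeff (Finsupp.single j n) f := by
  simp [edge]

theorem edge_inVar_self (j : Fin 2) (g : PowerSeries k) : edge j (inVar j g) = g := by
  ext n
  rw [coeff_edge, coeff_single_inVar_self]

theorem constantCoeff_edge (j : Fin 2) (f : PS k) :
    PowerSeries.constantCoeff (edge j f) = MvPowerSeries.constantCoeff f := by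
  rw [← PowerSeries.coeff_zero_eq_constantCoeff_apply, coeff_edge]
  simp

theorem constantCoeff_inVar (j : Fin 2) (f : PowerSeries k) :
    MvPowerSeries.constantCoeff (inVar j f) = PowerSeries.constantCoeff f := by
  rw [← constantCoeff_edge j, edge_inVar_self]

theorem edge_algebraMap (j : Fin 2) (r : k) :
    edge j (algebraMap k (PS k) r) = algebraMap k (PowerSeries k) r := by
  rw [← inVar_algebraMap j, edge_inVar_self]

theorem edge_X_self (j : Fin 2) : edge j (MvPowerSeries.X j : PS k) = PowerSeries.X := by
  rw [← inVar_X, edge_inVar_self]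

theorem X_dvd_iff_edge {i j : Fin 2} (hij : i ≠ j) (f : PS k) :
    MvPowerSeries.X i ∣ f ↔ edge j f = 0 := by
  rw [MvPowerSeries.X_dvd_iff]
  constructor
  · intro h
    ext n
    rw [coeff_edge, h _ (by simp [hij.symm]), map_zero]
  · intro h d hd
    have : d = Finsupp.single j (d j) := by
      ext l
      rcases eq_or_ne l j with rfl | hl
      · simp
      · rw [fin_two_eq_of_ne hij.symm hl, hd]
        simp [hij.symm]
    rw [this, ← coeff_edge, h, map_zero]

theorem edge_X_of_ne {i j : Fin 2} (hij : i ≠ j) : edge j (MvPowerSeries.X i : PS k) = 0 :=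
  (X_dvd_iff_edge hij _).1 dvd_rfl

theorem edge_inVar_of_ne {i j : Fin 2} (hij : i ≠ j) (g : PowerSeries k)
    (hg : PowerSeries.constantCoeff g = 0) : edge j (inVar i g) = 0 := by
  obtain ⟨g, rfl⟩ := PowerSeries.X_dvd_iff.2 hg
  rw [inVar_mul, inVar_X, map_mul, edge_X_of_ne hij, zero_mul]

theorem X_dvd_sub_inVar_edge {i j : Fin 2} (hij : i ≠ j) (f : PS k) :
    MvPowerSeries.X i ∣ f - inVar j (edge j f) := by
  rw [X_dvd_iff_edge hij, map_sub, edge_inVar_self, sub_self]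

theorem X_prime (i : Fin 2) : Prime (MvPowerSeries.X i : PS k) := by
  obtain ⟨j, hij⟩ : ∃ j : Fin 2, i ≠ j := ⟨i + 1, by omega⟩
  refine ⟨fun h => ?_, fun h => ?_, fun f g h => ?_⟩
  · have := edge_X_self (k := k) i
    rw [h, map_zero] at this
    exact PowerSeries.X_ne_zero this.symm
  · simpa [edge_X_of_ne hij] using h.map (edge j)
  · simpa [X_dvd_iff_edge hij] using h

theorem X_not_dvd_X {i j : Fin 2} (hij : i ≠ j) :
    ¬ (MvPowerSeries.X i : PS k) ∣ MvPowerSeries.X j := by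
  rw [X_dvd_iff_edge hij, edge_X_self]
  exact PowerSeries.X_ne_zero

theorem exists_not_X_pow_dvd (i : Fin 2) {f : PS k} (hf : f ≠ 0) :
    ∃ n, ¬ (MvPowerSeries.X i : PS k) ^ n ∣ f := by
  obtain ⟨d, hd⟩ : ∃ d, MvPowerSeries.coeff d f ≠ 0 := by
    by_contra! h
    exact hf (MvPowerSeries.ext h)
  exact ⟨d i + 1, fun h => hd (MvPowerSeries.X_pow_dvd_iff.1 h d (Nat.lt_succ_self _))⟩

/-- The power series of order at least `n`, that is, the `n`-th power of the maximal ideal. -/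
def orderIdeal (k : Type*) [Field k] (n : ℕ) : Ideal (PS k) where
  carrier := {f | (n : ℕ∞) ≤ f.order}
  zero_mem' := by simp
  add_mem' {f g} hf hg := (le_min hf hg).trans MvPowerSeries.min_order_le_add
  smul_mem' c f hf := by
    refine le_trans ?_ MvPowerSeries.le_order_mul
    exact le_trans hf le_add_self

theorem mem_orderIdeal {n : ℕ} {f : PS k} :
    f ∈ orderIdeal k n ↔ ∀ d : Fin 2 →₀ ℕ, d.degree < n → MvPowerSeries.coeff d f = 0 := by
  constructor
  · intro h d hd
    exact MvPowerSeries.coeff_of_lt_order (lt_of_lt_of_le (by exact_mod_cast hd) h)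
  · exact fun h => MvPowerSeries.nat_le_order h

theorem mem_orderIdeal_one {f : PS k} :
    f ∈ orderIdeal k 1 ↔ MvPowerSeries.constantCoeff f = 0 := by
  rw [mem_orderIdeal]
  constructor
  · intro h
    rw [← MvPowerSeries.coeff_zero_eq_constantCoeff_apply]
    exact h 0 (by simp)
  · intro h d hd
    obtain rfl : d = 0 := (Finsupp.degree_eq_zero_iff d).1 (by omega)
    simpa using h

theorem mul_mem_orderIdeal {m n : ℕ} {f g : PS k} (hf : f ∈ orderIdeal k m)
    (hg : g ∈ orderIdeal k n) : f * g ∈ orderIdeal k (m + n) := by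
  change ((m + n : ℕ) : ℕ∞) ≤ _
  push_cast
  exact (add_le_add hf hg).trans MvPowerSeries.le_order_mul

theorem orderIdeal_one_pow_le (n : ℕ) : orderIdeal k 1 ^ n ≤ orderIdeal k n := by
  induction n with
  | zero => exact fun f _ => mem_orderIdeal.2 (by simp)
  | succ n ih =>
    rw [pow_succ, Ideal.mul_le]
    exact fun f hf g hg => mul_mem_orderIdeal (ih hf) hg

theorem orderIdeal_anti {m n : ℕ} (h : m ≤ n) : orderIdeal k n ≤ orderIdeal k m :=
  fun _ hf => mem_orderIdeal.2 fun d hd => mem_orderIdeal.1 hf d (hd.trans_le h)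

theorem X_pow_mem_orderIdeal (i : Fin 2) (n : ℕ) :
    (MvPowerSeries.X i : PS k) ^ n ∈ orderIdeal k n :=
  orderIdeal_one_pow_le n (Ideal.pow_mem_pow (mem_orderIdeal_one.2 (by simp)) n)

theorem eq_zero_of_forall_mem_orderIdeal {f : PS k} (h : ∀ n, f ∈ orderIdeal k n) : f = 0 :=
  MvPowerSeries.ext fun d => mem_orderIdeal.1 (h (d.degree + 1)) d (Nat.lt_succ_self _)

/-- `k[[x, y]]` is complete: a sequence whose `n`-th difference has order at least `n` has a
limit. -/
theorem exists_limit (h : ℕ → PS k) (hh : ∀ n, h (n + 1) - h n ∈ orderIdeal k n) :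
    ∃ g, ∀ n, g - h n ∈ orderIdeal k n := by
  have key : ∀ d : Fin 2 →₀ ℕ, ∀ n, d.degree + 1 ≤ n →
      MvPowerSeries.coeff d (h n) = MvPowerSeries.coeff d (h (d.degree + 1)) := by
    intro d n hn
    induction n, hn using Nat.le_induction with
    | base => rfl
    | succ n hn ih =>
      have := mem_orderIdeal.1 (hh n) d (by omega)
      rw [map_sub, sub_eq_zero] at this
      rw [this, ih]
  let g : PS k := fun d => MvPowerSeries.coeff d (h (d.degree + 1))
  refine ⟨g, fun n => mem_orderIdeal.2 fun d hd => ?_⟩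
  rw [map_sub, key d n hd, sub_eq_zero]
  rfl

theorem PS.isUnit_iff {f : PS k} : IsUnit f ↔ MvPowerSeries.constantCoeff f ≠ 0 := by
  rw [MvPowerSeries.isUnit_iff_constantCoeff, isUnit_iff_ne_zero]

end

/-! ### Subalgebras closed under restriction to the axes -/

section

variable {k : Type*} [Field k]

/-- A subalgebra of `k[[x, y]]` that contains the variables, in which divisibility by a variable is
the same as in `k[[x, y]]`, and which contains `f(x, 0)` and `f(0, y)` together with `f`. -/
structure IsEdgeClosed (S : Subalgebra k (PS k)) : Prop where
  X_mem (i : Fin 2) : (MvPowerSeries.X i : PS k) ∈ S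
  of_X_mul_mem (i : Fin 2) {w : PS k} : MvPowerSeries.X i * w ∈ S → w ∈ S
  inVar_edge_mem (j : Fin 2) {f : PS k} : f ∈ S → inVar j (edge j f) ∈ S

/-- An edge-closed subalgebra that contains the inverses of its elements with nonzero constant
term. -/
structure IsLocalEdgeClosed (S : Subalgebra k (PS k)) : Prop extends IsEdgeClosed S where
  of_mul_eq_one {f g : PS k} : f ∈ S → f * g = 1 → g ∈ S

namespace IsEdgeClosed

variable {S : Subalgebra k (PS k)} (hS : IsEdgeClosed S)

include hS

/-- The variable `X i` as an element of the subalgebra. -/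
def var (i : Fin 2) : S := ⟨MvPowerSeries.X i, hS.X_mem i⟩

theorem coe_var (i : Fin 2) : (hS.var i : PS k) = MvPowerSeries.X i := rfl

theorem var_dvd_iff (i : Fin 2) (f : S) : hS.var i ∣ f ↔ MvPowerSeries.X i ∣ (f : PS k) := by
  constructor
  · rintro ⟨g, rfl⟩
    exact ⟨g, rfl⟩
  · rintro ⟨g, hg⟩
    exact ⟨⟨g, hS.of_X_mul_mem i (hg ▸ f.2)⟩, Subtype.ext hg⟩

theorem var_prime (i : Fin 2) : Prime (hS.var i) := by
  refine ⟨fun h => (X_prime (k := k) i).ne_zero (congrArg Subtype.val h), fun h => ?_,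
    fun f g h => ?_⟩
  · exact (X_prime (k := k) i).not_isUnit (h.map S.val)
  · rw [var_dvd_iff] at h ⊢
    rw [var_dvd_iff]
    exact (X_prime (k := k) i).dvd_or_dvd h

theorem var_not_dvd_var {i j : Fin 2} (hij : i ≠ j) : ¬ hS.var i ∣ hS.var j := by
  rw [var_dvd_iff]
  exact X_not_dvd_X hij

theorem of_X_pow_mul_mem (i : Fin 2) (n : ℕ) {w : PS k} (h : MvPowerSeries.X i ^ n * w ∈ S) :
    w ∈ S := by
  induction n with
  | zero => simpa using h
  | succ n ih => exact ih (hS.of_X_mul_mem i (by rwa [pow_succ', mul_assoc] at h))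

theorem exists_eq_var_pow_mul (i : Fin 2) {f : S} (hf : f ≠ 0) :
    ∃ n g, f = hS.var i ^ n * g ∧ ¬ hS.var i ∣ g := by
  obtain ⟨n, hn⟩ := exists_not_X_pow_dvd i (f := (f : PS k)) (by simpa using hf)
  have : FiniteMultiplicity (hS.var i) f :=
    ⟨n, fun h => hn ((pow_dvd_pow _ n.le_succ).trans (by simpa [coe_var] using map_dvd S.val h))⟩
  obtain ⟨g, h1, h2⟩ := this.exists_eq_pow_mul_and_not_dvd
  exact ⟨_, g, h1, h2⟩

/-- A nonzero power series in one variable that belongs to `S` is a power of the variable times an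
element of `S` with nonzero constant term. -/
theorem exists_inVar_eq {j : Fin 2} {g : PowerSeries k} (hg : g ≠ 0) (h : inVar j g ∈ S) :
    ∃ (n : ℕ) (u : S), inVar j g = MvPowerSeries.X j ^ n * (u : PS k) ∧
      MvPowerSeries.constantCoeff (u : PS k) ≠ 0 := by
  have : FiniteMultiplicity (PowerSeries.X : PowerSeries k) g :=
    FiniteMultiplicity.of_prime_left PowerSeries.X_prime hg
  obtain ⟨u, h1, h2⟩ := this.exists_eq_pow_mul_and_not_dvd
  have e : inVar j g = MvPowerSeries.X j ^ multiplicity PowerSeries.X g * inVar j u := by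
    rw [← inVar_X, ← inVarHom_apply, ← inVarHom_apply, ← inVarHom_apply, ← map_pow, ← map_mul, ← h1]
  refine ⟨_, ⟨inVar j u, hS.of_X_pow_mul_mem j _ (e ▸ h)⟩, e, ?_⟩
  rwa [constantCoeff_inVar, Ne, ← PowerSeries.X_dvd_iff]

/-- Every element `f` is congruent to `f(0, y)` modulo `x`, and likewise with the variables
exchanged. -/
theorem exists_eq_inVar_edge_add {i j : Fin 2} (hij : i ≠ j) (f : S) :
    ∃ w : S, (f : PS k) = inVar j (edge j (f : PS k)) + MvPowerSeries.X i * (w : PS k) := by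
  obtain ⟨w, hw⟩ := X_dvd_sub_inVar_edge hij (f : PS k)
  refine ⟨⟨w, hS.of_X_mul_mem i (hw ▸ sub_mem f.2 (hS.inVar_edge_mem j f.2))⟩, ?_⟩
  rw [← hw]
  ring

/-- The powers of the ideal `(x, y)` are cut out by the order. -/
theorem mem_span_pow_iff (n : ℕ) (f : S) :
    f ∈ Ideal.span {hS.var 0, hS.var 1} ^ n ↔ (f : PS k) ∈ orderIdeal k n := by
  constructor
  · intro h
    have hle : Ideal.span {hS.var 0, hS.var 1} ≤ (orderIdeal k 1).comap S.val := by
      rw [Ideal.span_le]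
      rintro v (rfl | rfl) <;> exact mem_orderIdeal_one.2 (by simp [coe_var])
    have h2 := Ideal.pow_right_mono hle n h
    exact orderIdeal_one_pow_le n (Ideal.le_comap_pow _ _ h2)
  · intro h
    -- write `f = f(0, y) + x * w`, where `y ^ (n + 1)` divides `f(0, y)` and `w` has order
    -- at least `n`
    induction n generalizing f with
    | zero => simp
    | succ n ih =>
      obtain ⟨w, hw⟩ := hS.exists_eq_inVar_edge_add (i := 0) (j := 1) (by decide) f
      obtain ⟨g, hg⟩ : (PowerSeries.X ^ (n + 1) : PowerSeries k) ∣ edge 1 (f : PS k) := by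
        rw [PowerSeries.X_pow_dvd_iff]
        intro m hm
        rw [coeff_edge]
        exact mem_orderIdeal.1 h _ (by simpa using hm)
      have e : inVar 1 (edge 1 (f : PS k)) = MvPowerSeries.X 1 ^ (n + 1) * inVar 1 g := by
        rw [hg, ← inVar_X, ← inVarHom_apply, ← inVarHom_apply, ← inVarHom_apply, map_mul, map_pow]
      have hgS : inVar 1 g ∈ S := hS.of_X_pow_mul_mem 1 (n + 1) (e ▸ hS.inVar_edge_mem 1 f.2)
      have hwo : (w : PS k) ∈ orderIdeal k n := by
        have h2 : MvPowerSeries.X 0 * (w : PS k) ∈ orderIdeal k (n + 1) := by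
          rw [← sub_eq_iff_eq_add'.2 hw, e]
          exact sub_mem h (Ideal.mul_mem_right _ _ (X_pow_mem_orderIdeal 1 (n + 1)))
        rw [mem_orderIdeal] at h2 ⊢
        intro d hd
        have := h2 (Finsupp.single 0 1 + d) (by simp; omega)
        rwa [MvPowerSeries.X, MvPowerSeries.coeff_add_monomial_mul, one_mul] at this
      have : f = hS.var 1 ^ (n + 1) * ⟨inVar 1 g, hgS⟩ + hS.var 0 * w := by
        apply Subtype.ext
        simpa [coe_var, ← e] using hw
      rw [this]
      refine add_mem
        (Ideal.mul_mem_right _ _ (Ideal.pow_mem_pow (Ideal.subset_span (by simp)) _)) ?_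
      rw [pow_succ']
      exact Ideal.mul_mem_mul (Ideal.subset_span (by simp)) (ih w hwo)

theorem mem_span_iff (f : S) : f ∈ Ideal.span {hS.var 0, hS.var 1} ↔
    MvPowerSeries.constantCoeff (f : PS k) = 0 := by
  rw [← mem_orderIdeal_one, ← hS.mem_span_pow_iff, pow_one]

end IsEdgeClosed

theorem isEdgeClosed_top : IsEdgeClosed (⊤ : Subalgebra k (PS k)) where
  X_mem _ := Algebra.mem_top
  of_X_mul_mem _ _ _ := Algebra.mem_top
  inVar_edge_mem _ _ _ := Algebra.mem_top

namespace IsEdgeClosed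

variable {S : Subalgebra k (PS k)} (hS : IsEdgeClosed S)

include hS

/-- `S` is dense in `k[[x, y]]`. -/
theorem exists_sub_mem_orderIdeal (n : ℕ) (g : PS k) : ∃ f : S, g - f ∈ orderIdeal k n := by
  induction n generalizing g with
  | zero => exact ⟨0, mem_orderIdeal.2 (by simp)⟩
  | succ n ih =>
    have h := (isEdgeClosed_top (k := k).mem_span_iff
      ⟨g - algebraMap k (PS k) (MvPowerSeries.constantCoeff g), Algebra.mem_top⟩).2 (by
        simp [MvPowerSeries.algebraMap_apply])
    obtain ⟨u, v, huv⟩ := Ideal.mem_span_pair.1 h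
    have huv := congrArg Subtype.val huv
    simp only [Subalgebra.coe_add, Subalgebra.coe_mul, coe_var] at huv
    obtain ⟨u', hu⟩ := ih u
    obtain ⟨v', hv⟩ := ih v
    refine ⟨algebraMap k S (MvPowerSeries.constantCoeff g) + u' * hS.var 0 + v' * hS.var 1, ?_⟩
    have hX : ∀ i : Fin 2, (MvPowerSeries.X i : PS k) ∈ orderIdeal k 1 := fun i =>
      mem_orderIdeal_one.2 (by simp)
    have := add_mem (mul_mem_orderIdeal hu (hX 0)) (mul_mem_orderIdeal hv (hX 1))
    convert this using 1
    simp only [Subalgebra.coe_add, Subalgebra.coe_mul, coe_var, Subalgebra.coe_algebraMap]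
    linear_combination -huv

/-- The `n`-th truncation `k[[x, y]] → S / (x, y) ^ n`. -/
def truncHom (n : ℕ) : PS k →ₐ[S] S ⧸ (Ideal.span {hS.var 0, hS.var 1}) ^ n :=
  have key : ∀ (g : PS k) (f : S), g - f ∈ orderIdeal k n →
      Ideal.Quotient.mk (Ideal.span {hS.var 0, hS.var 1} ^ n)
        (hS.exists_sub_mem_orderIdeal n g).choose = Ideal.Quotient.mk _ f := fun g f h => by
    rw [Ideal.Quotient.mk_eq_mk_iff_sub_mem, hS.mem_span_pow_iff]
    convert sub_mem h (hS.exists_sub_mem_orderIdeal n g).choose_spec using 1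
    simp
  have spec := fun g => (hS.exists_sub_mem_orderIdeal n g).choose_spec
  { toFun g := Ideal.Quotient.mk _ (hS.exists_sub_mem_orderIdeal n g).choose
    map_one' := key 1 1 (by simp)
    map_zero' := key 0 0 (by simp)
    map_add' f g := by
      rw [← map_add]
      refine key _ _ ?_
      convert add_mem (spec f) (spec g) using 1
      rw [Subalgebra.coe_add]
      ring
    map_mul' f g := by
      rw [← map_mul]
      refine key _ _ ?_
      convert add_mem (Ideal.mul_mem_right g _ (spec f)) (Ideal.mul_mem_left _
        ((hS.exists_sub_mem_orderIdeal n f).choose : PS k) (spec g)) using 1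
      rw [Subalgebra.coe_mul]
      ring
    commutes' f := key _ f (by
      change (f : PS k) - f ∈ _
      simp) }

theorem truncHom_eq_mk {n : ℕ} {g : PS k} {f : S} (h : g - f ∈ orderIdeal k n) :
    hS.truncHom n g = Ideal.Quotient.mk _ f := by
  change Ideal.Quotient.mk _ (hS.exists_sub_mem_orderIdeal n g).choose = _
  rw [Ideal.Quotient.mk_eq_mk_iff_sub_mem, hS.mem_span_pow_iff]
  convert sub_mem h (hS.exists_sub_mem_orderIdeal n g).choose_spec using 1
  simp

theorem truncHom_eq_mk_iff {n : ℕ} {g : PS k} {f : S} :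
    hS.truncHom n g = Ideal.Quotient.mk _ f ↔ g - f ∈ orderIdeal k n := by
  refine ⟨fun h => ?_, hS.truncHom_eq_mk⟩
  obtain ⟨f', hf'⟩ := hS.exists_sub_mem_orderIdeal n g
  rw [hS.truncHom_eq_mk hf', Ideal.Quotient.mk_eq_mk_iff_sub_mem, hS.mem_span_pow_iff] at h
  convert add_mem hf' h using 1
  simp

/-- The `(x, y)`-adic completion of an edge-closed subalgebra is `k[[x, y]]`. -/
theorem nonempty_adicCompletion_equiv :
    Nonempty (AdicCompletion (Ideal.span {hS.var 0, hS.var 1}) S ≃ₐ[S] PS k) := by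
  have compat : ∀ {m n : ℕ} (hle : m ≤ n),
      (Ideal.Quotient.factorₐ S (Ideal.pow_le_pow_right hle)).comp (hS.truncHom n)
        = hS.truncHom m := by
    intro m n hle
    ext g
    obtain ⟨f, hf⟩ := hS.exists_sub_mem_orderIdeal n g
    rw [AlgHom.comp_apply, hS.truncHom_eq_mk hf, hS.truncHom_eq_mk (orderIdeal_anti hle hf)]
    rfl
  refine ⟨(AlgEquiv.ofBijective (AdicCompletion.liftAlgHom _ hS.truncHom compat) ⟨?_, ?_⟩).symm⟩
  · rw [injective_iff_map_eq_zero]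
    intro g hg
    refine eq_zero_of_forall_mem_orderIdeal fun n => ?_
    have h := congrArg (AdicCompletion.evalₐ _ n) hg
    rw [AdicCompletion.evalₐ_liftAlgHom, map_zero, ← map_zero (Ideal.Quotient.mk _),
      hS.truncHom_eq_mk_iff] at h
    simpa using h
  · intro z
    obtain ⟨r, rfl⟩ := AdicCompletion.mk_surjective _ _ z
    obtain ⟨g, hg⟩ := exists_limit (fun n => (r n : PS k)) (fun n => by
      have h := (r.2 n.le_succ).symm
      rw [SModEq.sub_mem, smul_eq_mul, Ideal.mul_top, hS.mem_span_pow_iff] at h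
      exact h)
    refine ⟨g, AdicCompletion.ext_evalₐ fun n => ?_⟩
    rw [AdicCompletion.evalₐ_liftAlgHom, hS.truncHom_eq_mk (hg n), AdicCompletion.evalₐ_mk]

theorem isHausdorff : IsHausdorff (Ideal.span {hS.var 0, hS.var 1}) S := by
  refine ⟨fun f hf => Subtype.ext (eq_zero_of_forall_mem_orderIdeal fun n => ?_)⟩
  rw [← hS.mem_span_pow_iff]
  simpa [SModEq.zero] using hf n

end IsEdgeClosed

namespace IsLocalEdgeClosed

variable {S : Subalgebra k (PS k)} (hS : IsLocalEdgeClosed S)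

include hS

theorem isUnit_iff (f : S) : IsUnit f ↔ MvPowerSeries.constantCoeff (f : PS k) ≠ 0 := by
  rw [← PS.isUnit_iff]
  refine ⟨fun h => h.map S.val, fun h => ?_⟩
  obtain ⟨g, hg⟩ := h.exists_right_inv
  exact .of_mul_eq_one ⟨g, hS.of_mul_eq_one f.2 hg⟩ (Subtype.ext hg)

theorem isLocalRing : IsLocalRing S :=
  .of_nonunits_add fun f g hf hg => by
    rw [mem_nonunits_iff, hS.isUnit_iff, not_not] at hf hg ⊢
    simp [hf, hg]

theorem maximalIdeal_eq [IsLocalRing S] :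
    IsLocalRing.maximalIdeal S = Ideal.span {hS.var 0, hS.var 1} := by
  ext f
  rw [IsLocalRing.mem_maximalIdeal, mem_nonunits_iff, hS.isUnit_iff, not_not, hS.mem_span_iff]

theorem mem_of_mul_mem_of_constantCoeff_ne_zero {P : Ideal S} {f u : S}
    (hu : MvPowerSeries.constantCoeff (u : PS k) ≠ 0) (h : f * u ∈ P) : f ∈ P := by
  obtain ⟨v, hv⟩ := ((hS.isUnit_iff u).2 hu).exists_right_inv
  have := P.mul_mem_right v h
  rwa [mul_assoc, hv, mul_one] at this

theorem constantCoeff_eq_zero_of_mem {P : Ideal S} (hP : P ≠ ⊤) {f : S} (hf : f ∈ P) :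
    MvPowerSeries.constantCoeff (f : PS k) = 0 := by
  by_contra h
  exact hP (Ideal.eq_top_of_isUnit_mem _ hf ((hS.isUnit_iff f).2 h))

/-- The only primes that contain the variable `X i` are `(X i)` and the maximal ideal. -/
theorem eq_span_or_eq_of_var_mem {P : Ideal S} (hP : P.IsPrime) {i : Fin 2} (h : hS.var i ∈ P) :
    P = Ideal.span {hS.var i} ∨ P = Ideal.span {hS.var 0, hS.var 1} := by
  obtain ⟨j, hij⟩ : ∃ j : Fin 2, i ≠ j := ⟨i + 1, by omega⟩
  by_cases hle : P ≤ Ideal.span {hS.var i}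
  · exact .inl (le_antisymm hle ((Ideal.span_singleton_le_iff_mem _).2 h))
  right
  obtain ⟨f, hf, hfi⟩ := SetLike.not_le_iff_exists.1 hle
  rw [Ideal.mem_span_singleton, hS.var_dvd_iff, X_dvd_iff_edge hij] at hfi
  obtain ⟨n, u, hu, hu0⟩ := hS.toIsEdgeClosed.exists_inVar_eq hfi (hS.inVar_edge_mem j f.2)
  obtain ⟨w, hw⟩ := hS.exists_eq_inVar_edge_add hij f
  have e : hS.var j ^ n * u = f - hS.var i * w := by
    apply Subtype.ext
    simp only [Subalgebra.coe_mul, Subalgebra.coe_pow, hS.coe_var, AddSubgroupClass.coe_sub]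
    rw [← hu, hw]
    simp [edge_inVar_self, edge_X_of_ne hij]
  have hj : hS.var j ∈ P := hP.mem_of_pow_mem n (hS.mem_of_mul_mem_of_constantCoeff_ne_zero hu0
    (e ▸ sub_mem hf (P.mul_mem_right _ h)))
  have hall : ∀ l, hS.var l ∈ P := fun l => by
    by_cases hl : l = i
    · exact hl ▸ h
    · exact fin_two_eq_of_ne hij hl ▸ hj
  refine le_antisymm (fun g hg => ?_) ?_
  · rw [hS.mem_span_iff]
    exact hS.constantCoeff_eq_zero_of_mem hP.ne_top hg
  · rw [Ideal.span_le]
    rintro v (rfl | rfl) <;> exact hall _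

theorem span_isPrime : (Ideal.span {hS.var 0, hS.var 1}).IsPrime := by
  have := hS.isLocalRing
  rw [← hS.maximalIdeal_eq]
  infer_instance

theorem span_var_isPrime (i : Fin 2) : (Ideal.span {hS.var i}).IsPrime :=
  (Ideal.span_singleton_prime (hS.var_prime i).ne_zero).2 (hS.var_prime i)

theorem two_le_ringKrullDim : 2 ≤ ringKrullDim S := by
  have := hS.span_isPrime
  have := hS.span_var_isPrime 0
  let a : PrimeSpectrum S := ⟨⊥, Ideal.isPrime_bot⟩
  let b : PrimeSpectrum S := ⟨Ideal.span {hS.var 0}, inferInstance⟩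
  let c : PrimeSpectrum S := ⟨Ideal.span {hS.var 0, hS.var 1}, inferInstance⟩
  have hab : a < b := by
    rw [← PrimeSpectrum.asIdeal_lt_asIdeal, bot_lt_iff_ne_bot, Ne, Ideal.span_singleton_eq_bot]
    exact (hS.var_prime 0).ne_zero
  have hbc : b < c := by
    rw [← PrimeSpectrum.asIdeal_lt_asIdeal]
    refine lt_of_le_of_ne (Ideal.span_mono (by simp)) fun h => ?_
    have : hS.var 1 ∈ c.asIdeal := Ideal.subset_span (by simp)
    rw [← h] at this
    change _ ∈ Ideal.span _ at this
    rw [Ideal.mem_span_singleton] at this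
    exact hS.var_not_dvd_var (by decide) this
  exact Order.le_krullDim_iff.2 ⟨⟨2, ![a, b, c], fun i => by
    fin_cases i
    exacts [hab, hbc]⟩, rfl⟩

end IsLocalEdgeClosed

end

/-! ### The rings `U`, `B` and `A` -/

section

theorem exists_mul_mem_adjoin_of_algebraMap_mem {k R F : Type*} [Field k] [CommRing R]
    [Nontrivial R] [Field F] [Algebra k R] [Algebra k F] [Algebra R F] [IsScalarTower k R F]
    [FaithfulSMul R F] (S : Set R) {f : R}
    (h : algebraMap R F f ∈ IntermediateField.adjoin k (algebraMap R F '' S)) :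
    ∃ b ∈ Algebra.adjoin k S, b ≠ 0 ∧ b * f ∈ Algebra.adjoin k S := by
  have hinj : Function.Injective (algebraMap R F) := FaithfulSMul.algebraMap_injective R F
  have hm : ∀ r ∈ Algebra.adjoin k (algebraMap R F '' S),
      ∃ a ∈ Algebra.adjoin k S, algebraMap R F a = r := fun r hr => by
    have e : Algebra.adjoin k (algebraMap R F '' S) =
        (Algebra.adjoin k S).map (IsScalarTower.toAlgHom k R F) :=
      by rw [AlgHom.map_adjoin, IsScalarTower.coe_toAlgHom']
    rw [e, Subalgebra.mem_map] at hr
    simpa only [IsScalarTower.coe_toAlgHom'] using hr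
  obtain ⟨r, hr, t, ht, e⟩ := IntermediateField.mem_adjoin_iff_div.1 h
  obtain ⟨a, ha, rfl⟩ := hm r hr
  obtain ⟨b, hb, rfl⟩ := hm t ht
  rcases eq_or_ne b 0 with rfl | hb0
  · refine ⟨1, one_mem _, one_ne_zero, ?_⟩
    rw [map_zero, div_zero] at e
    rw [(map_eq_zero_iff _ hinj).1 e, mul_zero]
    exact zero_mem _
  · refine ⟨b, hb, hb0, ?_⟩
    rw [eq_div_iff ((map_ne_zero_iff _ hinj).2 hb0), ← map_mul] at e
    rwa [mul_comm, hinj e]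

variable {k : Type*} [Field k] (σ τ : PowerSeries k)

theorem mem_gens_iff (n : ℕ) (f : PS k) : f ∈ gens σ τ n ↔
    ∃ i : Fin 2, f = MvPowerSeries.X i ∨ f = inVar i (endpiece (![σ, τ] i) n) := by
  simp only [gens, Set.mem_insert_iff, Set.mem_singleton_iff, Fin.exists_fin_two,
    Matrix.cons_val_zero, Matrix.cons_val_one]
  tauto

theorem Un_le_U (n : ℕ) : Un σ τ n ≤ U σ τ := le_iSup (Un σ τ) n

theorem X_mem_Un (n : ℕ) (i : Fin 2) : (MvPowerSeries.X i : PS k) ∈ Un σ τ n :=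
  Algebra.subset_adjoin ((mem_gens_iff σ τ n _).2 ⟨i, .inl rfl⟩)

theorem inVar_endpiece_mem_Un (n : ℕ) (i : Fin 2) :
    inVar i (endpiece (![σ, τ] i) n) ∈ Un σ τ n :=
  Algebra.subset_adjoin ((mem_gens_iff σ τ n _).2 ⟨i, .inr rfl⟩)

theorem constantCoeff_endpiece (f : PowerSeries k) (n : ℕ) :
    PowerSeries.constantCoeff (endpiece f n) = 0 := by
  simp [endpiece, ← PowerSeries.coeff_zero_eq_constantCoeff_apply]

theorem endpiece_zero {f : PowerSeries k} (hf : PowerSeries.constantCoeff f = 0) :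
    endpiece f 0 = f := by
  ext j
  rcases j with _ | j
  · simpa [endpiece] using hf.symm
  · simp [endpiece]

theorem X_mem_U (i : Fin 2) : (MvPowerSeries.X i : PS k) ∈ U σ τ :=
  Un_le_U σ τ 0 (X_mem_Un σ τ 0 i)

/-- The endpieces of `σ` are divisible by `x` in `U`, so that every element `u` of `U` is congruent
modulo `x` to the element `u(0, y)` of `U`; likewise for `τ` and `y`. -/
theorem exists_eq_inVar_edge_add_of_mem_Un {i j : Fin 2} (hij : i ≠ j) {n : ℕ} {u : PS k}
    (hu : u ∈ Un σ τ n) :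
    inVar j (edge j u) ∈ U σ τ ∧
      ∃ w ∈ U σ τ, u = inVar j (edge j u) + MvPowerSeries.X i * w := by
  induction hu using Algebra.adjoin_induction with
  | mem f hf =>
    obtain ⟨l, h⟩ := (mem_gens_iff σ τ n f).1 hf
    rcases eq_or_ne l i with rfl | hl
    · have he : edge j f = 0 := by
        rcases h with rfl | rfl
        · exact edge_X_of_ne hij
        · exact edge_inVar_of_ne hij _ (constantCoeff_endpiece _ _)
      rw [he, inVar_zero]
      refine ⟨zero_mem _, ?_⟩
      rcases h with rfl | rfl
      · exact ⟨1, one_mem _, by simp⟩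
      · refine ⟨algebraMap k _ (PowerSeries.coeff (n + 1) (![σ, τ] l)) +
          inVar l (endpiece (![σ, τ] l) (n + 1)), add_mem (Subalgebra.algebraMap_mem _ _)
            (Un_le_U σ τ _ (inVar_endpiece_mem_Un σ τ (n + 1) l)), ?_⟩
        rw [inVar_endpiece_succ]
        ring
    · obtain rfl := fin_two_eq_of_ne hij hl
      have he : inVar l (edge l f) = f := by
        rcases h with rfl | rfl
        · rw [edge_X_self, inVar_X]
        · rw [edge_inVar_self]
      rw [he]
      exact ⟨Un_le_U σ τ n (Algebra.subset_adjoin hf), 0, zero_mem _, by simp⟩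
  | algebraMap r =>
    rw [edge_algebraMap, inVar_algebraMap]
    exact ⟨Subalgebra.algebraMap_mem _ _, 0, zero_mem _, by simp⟩
  | add f g _ _ hf hg =>
    obtain ⟨hf, u, hu, ef⟩ := hf
    obtain ⟨hg, v, hv, eg⟩ := hg
    rw [map_add, inVar_add]
    exact ⟨add_mem hf hg, u + v, add_mem hu hv, by linear_combination ef + eg⟩
  | mul f g hf' _ hf hg =>
    obtain ⟨hf, u, hu, ef⟩ := hf
    obtain ⟨hg, v, hv, eg⟩ := hg
    rw [map_mul, inVar_mul]
    exact ⟨mul_mem hf hg, u * inVar j (edge j g) + f * v,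
      add_mem (mul_mem hu hg) (mul_mem (Un_le_U σ τ n hf') hv), by
        linear_combination f * eg + inVar j (edge j g) * ef⟩

theorem isEdgeClosed_U : IsEdgeClosed (U σ τ) where
  X_mem i := X_mem_U σ τ i
  of_X_mul_mem i w hw := by
    obtain ⟨j, hij⟩ : ∃ j : Fin 2, i ≠ j := ⟨i + 1, by omega⟩
    obtain ⟨n, -, hn⟩ := (mem_U_iff σ τ _).1 hw
    obtain ⟨-, v, hv, e⟩ := exists_eq_inVar_edge_add_of_mem_Un σ τ hij hn
    rw [(X_dvd_iff_edge hij _).1 (dvd_mul_right _ _), inVar_zero, zero_add] at e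
    rwa [mul_left_cancel₀ (X_prime i).ne_zero e]
  inVar_edge_mem j f hf := by
    obtain ⟨i, hij⟩ : ∃ i : Fin 2, i ≠ j := ⟨j + 1, by omega⟩
    obtain ⟨n, -, hn⟩ := (mem_U_iff σ τ _).1 hf
    exact (exists_eq_inVar_edge_add_of_mem_Un σ τ hij hn).1

/-- `B` is the localization of `U` at the prime ideal of the elements without constant term. -/
theorem mem_B_iff_exists_mem_U (f : PS k) : f ∈ B σ τ ↔
    ∃ s ∈ U σ τ, MvPowerSeries.constantCoeff s ≠ 0 ∧ s * f ∈ U σ τ := by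
  rw [mem_B_iff]
  constructor
  · rintro ⟨n, -, a, s, hs, e⟩
    exact ⟨s, Un_le_U σ τ n s.2, fun h => hs ((mem_Pn_iff σ τ n s).2 h), e ▸ Un_le_U σ τ n a.2⟩
  · rintro ⟨s, hs, hs0, ha⟩
    obtain ⟨m, hm, hs⟩ := (mem_U_iff σ τ s).1 hs
    obtain ⟨n, hn, ha⟩ := (mem_U_iff σ τ _).1 ha
    exact ⟨max m n, by omega, ⟨_, Un_mono σ τ (le_max_right m n) ha⟩,
      ⟨s, Un_mono σ τ (le_max_left m n) hs⟩, by rwa [mem_Pn_iff], rfl⟩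

theorem U_le_B : U σ τ ≤ B σ τ := fun f hf =>
  (mem_B_iff_exists_mem_U σ τ f).2 ⟨1, one_mem _, by simp, by simpa using hf⟩

theorem isLocalEdgeClosed_B : IsLocalEdgeClosed (B σ τ) where
  X_mem i := U_le_B σ τ (X_mem_U σ τ i)
  of_X_mul_mem i w hw := by
    obtain ⟨s, hs, hs0, h⟩ := (mem_B_iff_exists_mem_U σ τ _).1 hw
    exact (mem_B_iff_exists_mem_U σ τ _).2 ⟨s, hs, hs0,
      (isEdgeClosed_U σ τ).of_X_mul_mem i (by rwa [mul_left_comm] at h)⟩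
  inVar_edge_mem j f hf := by
    obtain ⟨s, hs, hs0, h⟩ := (mem_B_iff_exists_mem_U σ τ _).1 hf
    refine (mem_B_iff_exists_mem_U σ τ _).2
      ⟨inVar j (edge j s), (isEdgeClosed_U σ τ).inVar_edge_mem j hs, ?_, ?_⟩
    · rwa [constantCoeff_inVar, constantCoeff_edge]
    · rw [← inVar_mul, ← map_mul]
      exact (isEdgeClosed_U σ τ).inVar_edge_mem j h
  of_mul_eq_one {f g} hf h := by
    obtain ⟨s, hs, hs0, h'⟩ := (mem_B_iff_exists_mem_U σ τ _).1 hf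
    have hf0 : MvPowerSeries.constantCoeff f ≠ 0 := PS.isUnit_iff.1 (.of_mul_eq_one g h)
    refine (mem_B_iff_exists_mem_U σ τ _).2 ⟨s * f, h', by simp [hs0, hf0], ?_⟩
    rwa [mul_assoc, h, mul_one]

/-- `A` is closed under those divisions that are possible in `k[[x, y]]`. -/
theorem mem_A_of_mul_mem {b f : PS k} (hb : b ∈ A σ τ) (hb0 : b ≠ 0) (h : b * f ∈ A σ τ) :
    f ∈ A σ τ := by
  change algebraMap (PS k) (FractionRing (PS k)) _ ∈ fieldL σ τ at hb h ⊢
  have hb1 : algebraMap (PS k) (FractionRing (PS k)) b ≠ 0 := by simpa using hb0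
  rw [map_mul] at h
  rw [← mul_div_cancel_left₀ (algebraMap (PS k) (FractionRing (PS k)) f) hb1]
  exact div_mem h hb

variable {σ τ} (hσ : PowerSeries.constantCoeff σ = 0) (hτ : PowerSeries.constantCoeff τ = 0)

include hσ hτ

theorem U_le_A : U σ τ ≤ A σ τ := by
  refine iSup_le fun n => Algebra.adjoin_le ?_
  have hs : ∀ i : Fin 2, inVar i (endpiece (![σ, τ] i) n) ∈ A σ τ := by
    intro i
    induction n with
    | zero =>
      refine IntermediateField.subset_adjoin _ _ (Set.mem_image_of_mem _ ?_)
      fin_cases i <;> simp [endpiece_zero, hσ, hτ]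
    | succ n ih =>
      rw [inVar_endpiece_succ] at ih
      refine mem_A_of_mul_mem σ τ (X_mem_A σ τ i) (X_prime i).ne_zero ?_
      exact (add_mem_cancel_left (mul_mem (Subalgebra.algebraMap_mem _ _) (X_mem_A σ τ i))).1 ih
  intro f hf
  obtain ⟨i, rfl | rfl⟩ := (mem_gens_iff σ τ n f).1 hf
  exacts [X_mem_A σ τ i, hs i]

theorem mem_A_iff_exists_mem_U (f : PS k) :
    f ∈ A σ τ ↔ ∃ b ∈ U σ τ, b ≠ 0 ∧ b * f ∈ U σ τ := by
  constructor
  · intro h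
    change algebraMap (PS k) (FractionRing (PS k)) f ∈ fieldL σ τ at h
    have hg : gens σ τ 0 =
        {MvPowerSeries.X 0, MvPowerSeries.X 1, inVar 0 σ, inVar 1 τ} := by
      rw [gens, endpiece_zero hσ, endpiece_zero hτ]
    rw [fieldL, ← hg] at h
    obtain ⟨b, hb, hb0, h⟩ := exists_mul_mem_adjoin_of_algebraMap_mem _ h
    exact ⟨b, Un_le_U σ τ 0 hb, hb0, Un_le_U σ τ 0 h⟩
  · rintro ⟨b, hb, hb0, h⟩
    exact mem_A_of_mul_mem σ τ (U_le_A hσ hτ hb) hb0 (U_le_A hσ hτ h)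

theorem isLocalEdgeClosed_A : IsLocalEdgeClosed (A σ τ) where
  X_mem i := X_mem_A σ τ i
  of_X_mul_mem i w hw := mem_A_of_mul_mem σ τ (X_mem_A σ τ i) (X_prime i).ne_zero hw
  inVar_edge_mem j f hf := by
    obtain ⟨i, hij⟩ : ∃ i : Fin 2, i ≠ j := ⟨j + 1, by omega⟩
    have hU := isEdgeClosed_U σ τ
    obtain ⟨b, hb, hb0, h⟩ := (mem_A_iff_exists_mem_U hσ hτ f).1 hf
    -- after division by a power of `X i`, the denominator does not vanish on the axis
    obtain ⟨n, c, hc, hci⟩ := hU.exists_eq_var_pow_mul i (f := ⟨b, hb⟩)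
      (fun h => hb0 (congrArg Subtype.val h))
    rw [hU.var_dvd_iff, X_dvd_iff_edge hij] at hci
    have hc' : b = MvPowerSeries.X i ^ n * (c : PS k) := congrArg Subtype.val hc
    rw [hc', mul_assoc] at h
    have hcf := hU.inVar_edge_mem j (hU.of_X_pow_mul_mem i n h)
    rw [map_mul, inVar_mul] at hcf
    refine (mem_A_iff_exists_mem_U hσ hτ _).2 ⟨_, hU.inVar_edge_mem j c.2, ?_, hcf⟩
    rw [← inVar_zero j]
    exact fun h => hci (inVar_injective j h)
  of_mul_eq_one {f g} hf h := by
    refine mem_A_of_mul_mem σ τ hf ?_ (h ▸ one_mem _)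
    rintro rfl
    simp at h

theorem B_le_A : B σ τ ≤ A σ τ := fun f hf => by
  obtain ⟨s, hs, hs0, h⟩ := (mem_B_iff_exists_mem_U σ τ f).1 hf
  exact (mem_A_iff_exists_mem_U hσ hτ f).2 ⟨s, hs, by rintro rfl; simp at hs0, h⟩

theorem birationallyDominates : BirationallyDominates (A σ τ) (B σ τ) where
  le := B_le_A hσ hτ
  isLocalRing_left := (isLocalEdgeClosed_A hσ hτ).isLocalRing
  isLocalRing_right := (isLocalEdgeClosed_B σ τ).isLocalRing
  exists_fraction f hf := by
    obtain ⟨b, hb, hb0, h⟩ := (mem_A_iff_exists_mem_U hσ hτ f).1 hf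
    exact ⟨_, U_le_B σ τ h, b, U_le_B σ τ hb, hb0, rfl⟩
  isLocalHom := ⟨fun f hf => by
    rw [(isLocalEdgeClosed_A hσ hτ).isUnit_iff] at hf
    rwa [(isLocalEdgeClosed_B σ τ).isUnit_iff]⟩

end

/-! ### The Noetherian property -/

section

variable {k : Type*} [Field k]

namespace IsLocalEdgeClosed

variable {S : Subalgebra k (PS k)} (hS : IsLocalEdgeClosed S)

include hS

/-- A prime `P` that does not contain `x` has an element `f` that divides every element of `P`
modulo `x`: one for which the order of `f(0, y)` is minimal. -/
theorem exists_forall_eq_mul_add {P : Ideal S} (hP : P.IsPrime) (hP0 : P ≠ ⊥)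
    (hx : hS.var 0 ∉ P) :
    ∃ f ∈ P, f ≠ 0 ∧ ∀ g ∈ P, ∃ q : S, ∃ h ∈ P, g = f * q + hS.var 0 * h := by
  have h01 : (0 : Fin 2) ≠ 1 := by decide
  have key : ∀ f : S, ¬ hS.var 0 ∣ f → ∃ (n : ℕ) (u : S),
      inVar 1 (edge 1 (f : PS k)) = MvPowerSeries.X 1 ^ n * (u : PS k) ∧ IsUnit u := fun f hf => by
    rw [hS.var_dvd_iff, X_dvd_iff_edge h01] at hf
    obtain ⟨n, u, hu, hu0⟩ := hS.toIsEdgeClosed.exists_inVar_eq hf (hS.inVar_edge_mem 1 f.2)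
    exact ⟨n, u, hu, (hS.isUnit_iff u).2 hu0⟩
  have hex : ∃ n : ℕ, ∃ f ∈ P, ∃ u : S,
      inVar 1 (edge 1 (f : PS k)) = MvPowerSeries.X 1 ^ n * (u : PS k) ∧ IsUnit u := by
    obtain ⟨f, hf, hf0⟩ := Submodule.exists_mem_ne_zero_of_ne_bot hP0
    obtain ⟨n, g, rfl, hg⟩ := hS.exists_eq_var_pow_mul 0 hf0
    have hgP : g ∈ P := (hP.mem_or_mem hf).resolve_left fun h => hx (hP.mem_of_pow_mem n h)
    obtain ⟨m, u, h⟩ := key g hg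
    exact ⟨m, g, hgP, u, h⟩
  classical
  obtain ⟨f, hf, u, hu, hu0⟩ := Nat.find_spec hex
  have hmin := fun m => Nat.find_min' hex (m := m)
  set n := Nat.find hex
  refine ⟨f, hf, ?_, fun g hg => ?_⟩
  · rintro rfl
    have h := hu.symm
    rw [Subalgebra.coe_zero, map_zero, inVar_zero] at h
    rcases mul_eq_zero.1 h with h | h
    · exact (X_prime (k := k) 1).ne_zero (eq_zero_of_pow_eq_zero h)
    · exact (hu0.map S.val).ne_zero h
  · obtain ⟨q, hq⟩ : ∃ q : S,
        inVar 1 (edge 1 (g : PS k)) = inVar 1 (edge 1 (f : PS k)) * (q : PS k) := by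
      by_cases hgx : hS.var 0 ∣ g
      · rw [hS.var_dvd_iff, X_dvd_iff_edge h01] at hgx
        exact ⟨0, by simp [hgx, inVar_zero]⟩
      · obtain ⟨m, v, hv, hv0⟩ := key g hgx
        obtain ⟨l, rfl⟩ := Nat.exists_eq_add_of_le (hmin m ⟨g, hg, v, hv, hv0⟩)
        obtain ⟨u', hu'⟩ := hu0.exists_right_inv
        have hu' : (u : PS k) * u' = 1 := congrArg Subtype.val hu'
        refine ⟨hS.var 1 ^ l * v * u', ?_⟩
        rw [hv, hu]
        simp only [Subalgebra.coe_mul, Subalgebra.coe_pow, hS.coe_var]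
        linear_combination - MvPowerSeries.X 1 ^ n * MvPowerSeries.X 1 ^ l * (v : PS k) * hu'
    obtain ⟨w, hw⟩ := hS.exists_eq_inVar_edge_add h01 f
    obtain ⟨z, hz⟩ := hS.exists_eq_inVar_edge_add h01 g
    have e : g = f * q + hS.var 0 * (z - w * q) := by
      apply Subtype.ext
      simp only [Subalgebra.coe_add, Subalgebra.coe_mul, hS.coe_var, AddSubgroupClass.coe_sub]
      linear_combination hz + hq - (q : PS k) * hw
    refine ⟨q, z - w * q, (hP.mem_or_mem (x := hS.var 0) ?_).resolve_left hx, e⟩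
    rw [← sub_eq_iff_eq_add'.2 e]
    exact sub_mem hg (P.mul_mem_right _ hf)

/-- If `S` is closed under the divisions that are possible in `k[[x, y]]`, then it is Noetherian: a
prime that does not contain `x` is principal, because a generator modulo `x` generates it in
`k[[x, y]]`, by successive approximation. -/
theorem isNoetherianRing (hdiv : ∀ {b f : PS k}, b ∈ S → b ≠ 0 → b * f ∈ S → f ∈ S) :
    IsNoetherianRing S := by
  refine IsNoetherianRing.of_prime_ne_bot fun P hP hP0 => ?_
  by_cases hx : hS.var 0 ∈ P
  · rcases hS.eq_span_or_eq_of_var_mem hP hx with rfl | rfl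
    · exact ⟨{hS.var 0}, by simp⟩
    · exact Submodule.fg_span (by simp)
  obtain ⟨f, hf, hf0, hstep⟩ := hS.exists_forall_eq_mul_add hP hP0 hx
  have hf0' : (f : PS k) ≠ 0 := by simpa using hf0
  choose! q h hh hqh using hstep
  suffices P = Ideal.span {f} by
    rw [this]
    exact Submodule.fg_span (by simp)
  refine le_antisymm (fun g hg => ?_) ((Ideal.span_singleton_le_iff_mem _).2 hf)
  have hP' : ∀ n, h^[n] g ∈ P := fun n => by
    induction n with
    | zero => exact hg
    | succ n ih =>
      rw [Function.iterate_succ_apply']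
      exact hh _ ih
  let H : ℕ → S := fun n => ∑ i ∈ Finset.range n, hS.var 0 ^ i * q (h^[i] g)
  have hH : ∀ n, g = f * H n + hS.var 0 ^ n * h^[n] g := fun n => by
    induction n with
    | zero => simp [H]
    | succ n ih =>
      have e := hqh _ (hP' n)
      rw [← Function.iterate_succ_apply' h n g] at e
      simp only [H, Finset.sum_range_succ] at ih ⊢
      linear_combination ih + hS.var 0 ^ n * e
  have hXn : ∀ n, ((hS.var 0 ^ n : S) : PS k) ∈ orderIdeal k n := fun n => by
    rw [Subalgebra.coe_pow, hS.coe_var]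
    exact X_pow_mem_orderIdeal 0 n
  obtain ⟨L, hL⟩ := exists_limit (fun n => (H n : PS k)) (fun n => by
    simp only [H, Finset.sum_range_succ, Subalgebra.coe_add, add_sub_cancel_left]
    rw [Subalgebra.coe_mul]
    exact Ideal.mul_mem_right _ _ (hXn n))
  have hfL : (f : PS k) * L = g := by
    refine sub_eq_zero.1 (eq_zero_of_forall_mem_orderIdeal fun n => ?_)
    have e := congrArg Subtype.val (hH n)
    rw [Subalgebra.coe_add, Subalgebra.coe_mul, Subalgebra.coe_mul] at e
    convert sub_mem (Ideal.mul_mem_left _ (f : PS k) (hL n))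
      (Ideal.mul_mem_right ((h^[n] g : S) : PS k) _ (hXn n)) using 1
    linear_combination -e
  exact Ideal.mem_span_singleton.2 ⟨⟨L, hdiv f.2 hf0' (hfL ▸ g.2)⟩, Subtype.ext hfL.symm⟩

theorem ringKrullDim_eq_two [IsNoetherianRing S] : ringKrullDim S = 2 := by
  have := hS.isLocalRing
  refine le_antisymm ?_ hS.two_le_ringKrullDim
  refine (ringKrullDim_le_spanFinrank_maximalIdeal S).trans ?_
  rw [hS.maximalIdeal_eq]
  exact_mod_cast (Submodule.spanFinrank_span_le_ncard_of_finite (by simp)).trans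
    ((Set.ncard_insert_le _ _).trans (by simp))

theorem isRegularLocalRing [IsNoetherianRing S] : IsRegularLocalRing S := by
  have := hS.isLocalRing
  refine IsRegularLocalRing.of_spanFinrank_maximalIdeal_le S ?_
  rw [hS.ringKrullDim_eq_two, hS.maximalIdeal_eq]
  exact_mod_cast (Submodule.spanFinrank_span_le_ncard_of_finite (by simp)).trans
    ((Set.ncard_insert_le _ _).trans (by simp))

end IsLocalEdgeClosed

end

/-! ### Factoriality -/

section

theorem dvd_of_dvd_prime_pow_mul {R : Type*} [CommRing R] [IsDomain R] {p v g : R} (hp : Prime p)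
    (hv : ¬ p ∣ v) {n : ℕ} (h : v ∣ p ^ n * g) : v ∣ g := by
  obtain ⟨c, hc⟩ := h
  obtain ⟨d, rfl⟩ := hp.pow_dvd_of_dvd_mul_left n hv (hc ▸ dvd_mul_right _ _)
  refine ⟨d, mul_left_cancel₀ (pow_ne_zero n hp.ne_zero) ?_⟩
  rw [hc]
  ring

/-- A form of Nagata's criterion. Let `S` be a factorial subring of `R`, and let `x` and `y` be
elements of `S` that are prime in `R` and of which every nonzero element of `R` is divisible only
finitely often. If every element of `R` has a multiple in `S` by an element of `S` that is, up to a
unit of `R`, a power of `x * y`, then `R` is factorial. -/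
theorem uniqueFactorizationMonoid_of_prime_of_prime {S R : Type*} [CommRing S] [IsDomain S]
    [UniqueFactorizationMonoid S] [CommRing R] [IsDomain R] (φ : S →+* R)
    (hφ : Function.Injective φ) {x y : S} (hx : Prime (φ x)) (hy : Prime (φ y))
    (hx' : ∀ f : R, f ≠ 0 → ∃ n g, f = φ x ^ n * g ∧ ¬ φ x ∣ g)
    (hy' : ∀ f : R, f ≠ 0 → ∃ n g, f = φ y ^ n * g ∧ ¬ φ y ∣ g)
    (hfrac : ∀ b : R, ∃ s t N, Associated (φ s) (φ x ^ N * φ y ^ N) ∧ φ t = φ s * b) :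
    UniqueFactorizationMonoid R := by
  rw [UniqueFactorizationMonoid.iff_exists_prime_mem_of_isPrime]
  intro P hP0 hP
  by_cases hxP : φ x ∈ P
  · exact ⟨_, hxP, hx⟩
  by_cases hyP : φ y ∈ P
  · exact ⟨_, hyP, hy⟩
  have hass : ∀ {s : S} {N : ℕ}, Associated (φ s) (φ x ^ N * φ y ^ N) → φ s ∉ P := by
    intro s N h hs
    rcases hP.mem_or_mem (P.mem_of_dvd h.dvd hs) with h | h
    exacts [hxP (hP.mem_of_pow_mem _ h), hyP (hP.mem_of_pow_mem _ h)]
  obtain ⟨f, hf, hf0⟩ := Submodule.exists_mem_ne_zero_of_ne_bot hP0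
  obtain ⟨s, t, N, hs, ht⟩ := hfrac f
  have htP : t ∈ P.comap φ := by
    rw [Ideal.mem_comap, ht]
    exact P.mul_mem_left _ hf
  have ht0 : t ≠ 0 := by
    rintro rfl
    rw [map_zero, eq_comm, mul_eq_zero] at ht
    exact hass hs ((ht.resolve_right hf0).symm ▸ P.zero_mem)
  obtain ⟨q, hqP, hq⟩ := (hP.comap φ).exists_mem_prime_of_ne_bot
    (Submodule.ne_bot_iff _ |>.2 ⟨t, htP, ht0⟩)
  rw [Ideal.mem_comap] at hqP
  -- `v` is the prime element `q` of `S`, stripped of the factors `x` and `y` that it has in `R`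
  obtain ⟨a, v₁, hv₁, hxv₁⟩ := hx' (φ q) ((map_ne_zero_iff φ hφ).2 hq.ne_zero)
  obtain ⟨b, v, rfl, hyv⟩ := hy' v₁ (by rintro rfl; exact hxv₁ (dvd_zero _))
  have hxv : ¬ φ x ∣ v := fun h => hxv₁ (h.mul_left _)
  have hvP : v ∈ P := by
    rw [hv₁] at hqP
    exact (hP.mem_or_mem ((hP.mem_or_mem hqP).resolve_left
      fun h => hxP (hP.mem_of_pow_mem _ h))).resolve_left fun h => hyP (hP.mem_of_pow_mem _ h)
  -- `v` is prime: in a relation `v * w = g * h`, clear the denominators and use that `q` is prime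
  have hcancel : ∀ {s t : S} {N : ℕ} {g : R}, Associated (φ s) (φ x ^ N * φ y ^ N) →
      φ t = φ s * g → q ∣ t → v ∣ g := by
    intro s t N g hs ht hqt
    have h1 : v ∣ φ q := ⟨φ x ^ a * φ y ^ b, by rw [hv₁]; ring⟩
    have h2 : v ∣ φ s * g := ht ▸ h1.trans (map_dvd φ hqt)
    have h3 : v ∣ φ x ^ N * (φ y ^ N * g) := by
      rw [← mul_assoc]
      exact ((hs.mul_right g).dvd_iff_dvd_right).1 h2
    exact dvd_of_dvd_prime_pow_mul hy hyv (dvd_of_dvd_prime_pow_mul hx hxv h3)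
  refine ⟨v, hvP, fun h => hxv (h ▸ dvd_zero _), fun h => hP.ne_top (P.eq_top_of_isUnit_mem hvP h),
    fun g h hgh => ?_⟩
  obtain ⟨w, hw⟩ := hgh
  obtain ⟨sg, tg, Ng, hsg, htg⟩ := hfrac g
  obtain ⟨sh, th, Nh, hsh, hth⟩ := hfrac h
  obtain ⟨sw, tw, Nw, hsw, htw⟩ := hfrac w
  have e : q * (tw * sg * sh) = x ^ a * (y ^ b * (sw * (tg * th))) := by
    apply hφ
    simp only [map_mul, map_pow, htg, hth, htw, hv₁]
    linear_combination - φ x ^ a * φ y ^ b * φ sg * φ sh * φ sw * hw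
  have hd : q ∣ x ^ a * (y ^ b * (sw * (tg * th))) := ⟨_, e.symm⟩
  have hn : ∀ z : S, φ z ∉ P → ¬ q ∣ z := fun z hz h => hz (P.mem_of_dvd (map_dvd φ h) hqP)
  have hd := (hq.dvd_or_dvd ((hq.dvd_or_dvd ((hq.dvd_or_dvd hd).resolve_left
    fun h => hn x hxP (hq.dvd_of_dvd_pow h))).resolve_left
    fun h => hn y hyP (hq.dvd_of_dvd_pow h))).resolve_left (hn sw (hass hsw))
  exact (hq.dvd_or_dvd hd).imp (hcancel hsg htg) (hcancel hsh hth)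

/-! ### Krull domains -/

section Krull

variable {R : Type*} [CommRing R] [IsDomain R] [UniqueFactorizationMonoid R]

theorem exists_eq_pow_mul_and_not_dvd_of_prime {p : R} (hp : Prime p) {r : R} (hr : r ≠ 0) :
    ∃ n c, ¬ p ∣ c ∧ r = p ^ n * c := by
  obtain ⟨c, h1, h2⟩ := (FiniteMultiplicity.of_prime_left hp hr).exists_eq_pow_mul_and_not_dvd
  exact ⟨_, c, h2, h1⟩

/-- The localization of a factorial domain at the principal prime ideal `(p)`, as a valuation
subring of the field of fractions. -/
def valuationSubringOfPrime (p : R) (hp : Prime p) : ValuationSubring (FractionRing R) where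
  carrier := {a | ∃ r s, ¬ p ∣ s ∧ a * algebraMap R _ s = algebraMap R _ r}
  mul_mem' := by
    rintro a b ⟨r, s, hs, e⟩ ⟨r', s', hs', e'⟩
    refine ⟨r * r', s * s', fun h => (hp.dvd_or_dvd h).elim hs hs', ?_⟩
    rw [map_mul, map_mul, ← e, ← e']
    ring
  one_mem' := ⟨1, 1, fun h => hp.not_isUnit (isUnit_of_dvd_one h), by simp⟩
  add_mem' := by
    rintro a b ⟨r, s, hs, e⟩ ⟨r', s', hs', e'⟩
    refine ⟨r * s' + r' * s, s * s', fun h => (hp.dvd_or_dvd h).elim hs hs', ?_⟩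
    simp only [map_mul, map_add, ← e, ← e']
    ring
  zero_mem' := ⟨0, 1, fun h => hp.not_isUnit (isUnit_of_dvd_one h), by simp⟩
  neg_mem' := by
    rintro a ⟨r, s, hs, e⟩
    exact ⟨-r, s, hs, by rw [map_neg, ← e, neg_mul]⟩
  mem_or_inv_mem' := by
    intro a
    obtain ⟨r, s, hs, rfl⟩ := IsFractionRing.div_surjective (A := R) a
    have hs0 := nonZeroDivisors.ne_zero hs
    have hinj : ∀ {z : R}, z ≠ 0 → algebraMap R (FractionRing R) z ≠ 0 := fun hz => by
      simpa using hz
    rcases eq_or_ne r 0 with rfl | hr0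
    · exact .inl ⟨0, 1, fun h => hp.not_isUnit (isUnit_of_dvd_one h), by simp⟩
    obtain ⟨m, r', hr', rfl⟩ := exists_eq_pow_mul_and_not_dvd_of_prime hp hr0
    obtain ⟨n, s', hs', rfl⟩ := exists_eq_pow_mul_and_not_dvd_of_prime hp hs0
    have hp0 := hinj hp.ne_zero
    have hr1 := hinj (right_ne_zero_of_mul hr0)
    have hs1 := hinj (right_ne_zero_of_mul hs0)
    rcases le_total n m with h | h
    · obtain ⟨l, rfl⟩ := Nat.exists_eq_add_of_le h
      refine .inl ⟨p ^ l * r', s', hs', ?_⟩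
      simp only [map_mul, map_pow]
      field_simp
      ring
    · obtain ⟨l, rfl⟩ := Nat.exists_eq_add_of_le h
      refine .inr ⟨p ^ l * s', r', hr', ?_⟩
      simp only [map_mul, map_pow]
      field_simp
      ring

theorem mem_valuationSubringOfPrime {p : R} {hp : Prime p} {a : FractionRing R} :
    a ∈ valuationSubringOfPrime p hp ↔
      ∃ r s, ¬ p ∣ s ∧ a * algebraMap R _ s = algebraMap R _ r := Iff.rfl

theorem algebraMap_mem_valuationSubringOfPrime {p : R} (hp : Prime p) (r : R) :
    algebraMap R (FractionRing R) r ∈ valuationSubringOfPrime p hp :=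
  mem_valuationSubringOfPrime.2 ⟨r, 1, fun h => hp.not_isUnit (isUnit_of_dvd_one h), by simp⟩

theorem inv_algebraMap_mem_valuationSubringOfPrime_iff {p : R} (hp : Prime p) {r : R} (hr : r ≠ 0) :
    (algebraMap R (FractionRing R) r)⁻¹ ∈ valuationSubringOfPrime p hp ↔ ¬ p ∣ r := by
  have hr0 : algebraMap R (FractionRing R) r ≠ 0 := by simpa using hr
  rw [mem_valuationSubringOfPrime]
  constructor
  · rintro ⟨c, s, hs, e⟩ hpr
    rw [inv_mul_eq_iff_eq_mul₀ hr0, ← map_mul] at e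
    exact hs (IsFractionRing.injective R (FractionRing R) e ▸ hpr.mul_right c)
  · exact fun h => ⟨1, r, h, by simp [hr0]⟩

theorem isDiscreteValuationRing_valuationSubringOfPrime {p : R} (hp : Prime p) :
    IsDiscreteValuationRing (valuationSubringOfPrime p hp) := by
  set V := valuationSubringOfPrime p hp
  have hp0 : algebraMap R (FractionRing R) p ≠ 0 := by simpa using hp.ne_zero
  let ϖ : V := ⟨algebraMap R _ p, algebraMap_mem_valuationSubringOfPrime hp p⟩
  have hϖ0 : ϖ ≠ 0 := fun h => hp0 (congrArg Subtype.val h)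
  have hϖ : ¬ IsUnit ϖ := fun h => by
    obtain ⟨w, hw⟩ := h.exists_right_inv
    have hw : algebraMap R (FractionRing R) p * w = 1 := congrArg Subtype.val hw
    have : (algebraMap R (FractionRing R) p)⁻¹ ∈ V := by
      rw [← eq_inv_of_mul_eq_one_right hw]
      exact w.2
    exact (inv_algebraMap_mem_valuationSubringOfPrime_iff hp hp.ne_zero).1 this dvd_rfl
  have key : ∀ {a : V}, a ≠ 0 → ∃ n, Associated (ϖ ^ n) a := by
    intro a ha
    obtain ⟨r, s, hs, e⟩ := mem_valuationSubringOfPrime.1 a.2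
    have hs0 : s ≠ 0 := by
      rintro rfl
      exact hs (dvd_zero _)
    have hs1 : algebraMap R (FractionRing R) s ≠ 0 := by simpa using hs0
    have hr0 : r ≠ 0 := by
      rintro rfl
      rw [map_zero, mul_eq_zero] at e
      exact ha (Subtype.ext (e.resolve_right hs1))
    obtain ⟨n, c, hc, rfl⟩ := exists_eq_pow_mul_and_not_dvd_of_prime hp hr0
    have hc0 := right_ne_zero_of_mul hr0
    have hc1 : algebraMap R (FractionRing R) c ≠ 0 := by simpa using hc0
    have hm : ∀ {b d : R}, ¬ p ∣ d → d ≠ 0 →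
        algebraMap R (FractionRing R) b * (algebraMap R (FractionRing R) d)⁻¹ ∈ V := fun h h0 =>
      mul_mem (algebraMap_mem_valuationSubringOfPrime hp _)
        ((inv_algebraMap_mem_valuationSubringOfPrime_iff hp h0).2 h)
    let u : Vˣ := ⟨⟨_, hm (b := c) hs hs0⟩, ⟨_, hm (b := s) hc hc0⟩,
      Subtype.ext (by simp; field_simp), Subtype.ext (by simp; field_simp)⟩
    refine ⟨n, u, Subtype.ext ?_⟩
    change algebraMap R (FractionRing R) p ^ n * (algebraMap R _ c * (algebraMap R _ s)⁻¹) = a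
    rw [← mul_assoc, ← map_pow, ← map_mul, ← e, mul_inv_cancel_right₀ hs1]
  refine IsDiscreteValuationRing.ofHasUnitMulPowIrreducibleFactorization ⟨ϖ, ⟨hϖ, ?_⟩, key⟩
  intro a b hab
  by_contra! h
  have hd : ∀ {a : V}, a ≠ 0 → ¬ IsUnit a → ϖ ∣ a := by
    intro a ha hu
    obtain ⟨n, hn⟩ := key ha
    rcases n with _ | n
    · rw [pow_zero] at hn
      exact absurd (hn.isUnit isUnit_one) hu
    · exact (dvd_pow_self _ n.succ_ne_zero).trans hn.dvd
  obtain ⟨c, rfl⟩ := hd (left_ne_zero_of_mul (hab ▸ hϖ0)) h.1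
  obtain ⟨d, rfl⟩ := hd (right_ne_zero_of_mul (hab ▸ hϖ0)) h.2
  refine hϖ (.of_mul_eq_one (c * d) (mul_left_cancel₀ hϖ0 ?_))
  rw [mul_one]
  nth_rw 3 [hab]
  ring

theorem valuation_eq_one_of_mem_of_inv_mem {K : Type*} [Field K] (V : ValuationSubring K) {a : K}
    (ha0 : a ≠ 0) (ha : a ∈ V) (ha' : a⁻¹ ∈ V) : V.valuation a = 1 := by
  rw [← V.valuation_le_one_iff] at ha ha'
  refine le_antisymm ha ?_
  rw [map_inv₀] at ha'
  exact (inv_le_one₀ (by simpa [zero_lt_iff] using ha0)).1 ha'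

/-- A factorial domain is a Krull domain, with the localizations at its principal primes as
defining family of discrete valuation rings. -/
theorem isKrullDomain_of_uniqueFactorizationMonoid : IsKrullDomain R := by
  refine ⟨{V | ∃ p, ∃ hp : Prime p, V = valuationSubringOfPrime p hp}, ?_, fun a => ?_,
    fun a ha => ?_⟩
  · rintro _ ⟨p, hp, rfl⟩
    exact isDiscreteValuationRing_valuationSubringOfPrime hp
  · constructor
    · rintro ⟨r, rfl⟩ _ ⟨p, hp, rfl⟩
      exact algebraMap_mem_valuationSubringOfPrime hp r
    · intro h
      obtain ⟨r, s, hrs, e⟩ := IsFractionRing.exists_reduced_fraction (A := R) a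
      have hs0 := nonZeroDivisors.ne_zero s.2
      rw [IsFractionRing.mk'_eq_div] at e
      by_cases hs : IsUnit (s : R)
      · obtain ⟨c, hc⟩ := hs.exists_right_inv
        refine ⟨r * c, ?_⟩
        have hs1 : algebraMap R (FractionRing R) s ≠ 0 := by simp
        rw [← e, eq_div_iff hs1, ← map_mul, mul_assoc, mul_comm c, hc, mul_one]
      · exfalso
        obtain ⟨p, hp, hps⟩ := WfDvdMonoid.exists_irreducible_factor hs hs0
        have hp := hp.prime
        obtain ⟨c, d, hd, e'⟩ := mem_valuationSubringOfPrime.1 (h _ ⟨p, hp, rfl⟩)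
        have hs1 : algebraMap R (FractionRing R) s ≠ 0 := by simp
        rw [← e, div_mul_eq_mul_div, div_eq_iff hs1, ← map_mul, ← map_mul] at e'
        have e' := IsFractionRing.injective R (FractionRing R) e'
        have hpr : p ∣ r := (hp.dvd_or_dvd (e' ▸ hps.mul_left c : p ∣ r * d)).resolve_right hd
        exact hp.not_isUnit (hrs hpr hps)
  · obtain ⟨r, s, hs, rfl⟩ := IsFractionRing.div_surjective (A := R) a
    have hs0 := nonZeroDivisors.ne_zero hs
    have hr0 : r ≠ 0 := by
      rintro rfl
      simp at ha
    classical
    have hfin : {V | ∃ p ∈ UniqueFactorizationMonoid.factors (r * s),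
        ∃ hp : Prime p, V = valuationSubringOfPrime p hp}.Finite := by
      have := (UniqueFactorizationMonoid.factors (r * s)).toFinset.finite_toSet.image
        fun p => if hp : Prime p then valuationSubringOfPrime p hp else ⊤
      refine this.subset ?_
      rintro _ ⟨p, hpm, hp, rfl⟩
      exact ⟨p, by simpa using hpm, by simp [hp]⟩
    refine hfin.subset ?_
    rintro _ ⟨⟨p, hp, rfl⟩, hV⟩
    have hprs : p ∣ r * s := by
      by_contra h
      have hpr : ¬ p ∣ r := fun h' => h (h'.mul_right s)
      have hps : ¬ p ∣ s := fun h' => h (h'.mul_left r)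
      refine hV (valuation_eq_one_of_mem_of_inv_mem _ ha ?_ ?_)
      · rw [div_eq_mul_inv]
        exact mul_mem (algebraMap_mem_valuationSubringOfPrime hp _)
          ((inv_algebraMap_mem_valuationSubringOfPrime_iff hp hs0).2 hps)
      · rw [inv_div, div_eq_mul_inv]
        exact mul_mem (algebraMap_mem_valuationSubringOfPrime hp _)
          ((inv_algebraMap_mem_valuationSubringOfPrime_iff hp hr0).2 hpr)
    obtain ⟨q, hq, hpq⟩ := UniqueFactorizationMonoid.exists_mem_factors_of_dvd
      (mul_ne_zero hr0 hs0) hp.irreducible hprs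
    refine ⟨q, hq, hpq.prime hp, ?_⟩
    ext b
    simp only [mem_valuationSubringOfPrime, hpq.dvd_iff_dvd_left]

end Krull

end

/-! ### Polynomials in `x`, `σ`, `y` and `τ` -/

section

variable {k : Type*} [Field k]

open scoped RatFunc in
/-- Transcendence over the field `k(x)` is the same as transcendence over the ring `k[x]`. -/
theorem transcendental_coe_laurentSeries_iff (f : PowerSeries k) :
    Transcendental (RatFunc k) (f : LaurentSeries k) ↔ Transcendental (Polynomial k) f := by
  rw [Transcendental, ← IsFractionRing.isAlgebraic_iff (Polynomial k) (RatFunc k) (LaurentSeries k)]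
  have hinj : Function.Injective (algebraMap (PowerSeries k) (LaurentSeries k)) :=
    FaithfulSMul.algebraMap_injective _ _
  have key : ∀ p : Polynomial (Polynomial k), Polynomial.aeval (f : LaurentSeries k) p = 0 ↔
      Polynomial.aeval f p = 0 := fun p => by
    rw [← map_eq_zero_iff _ hinj, Polynomial.aeval_def, Polynomial.aeval_def, Polynomial.hom_eval₂]
    rfl
  simp only [Transcendental, IsAlgebraic, key]

/-- Evaluation of polynomials in two variables at `(X, f)`. -/
def aevalX (f : PowerSeries k) : MvPolynomial (Fin 2) k →ₐ[k] PowerSeries k :=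
  MvPolynomial.aeval ![PowerSeries.X, f]

theorem aevalX_injective {f : PowerSeries k} (hf : Transcendental (Polynomial k) f) :
    Function.Injective (aevalX f) := by
  have h := (algebraicIndependent_unique_type_iff (ι := Unit) (R := k)
    (x := fun _ => (Polynomial.X : Polynomial k))).2 (Polynomial.transcendental_X k)
  have h' := (algebraicIndependent_unique_type_iff (ι := Unit) (R := Polynomial k)
    (x := fun _ => f)).2 hf
  have := (h.sumElim_comp h').comp (![.inr (), .inl ()] : Fin 2 → Unit ⊕ Unit) (by
    intro i j
    fin_cases i <;> fin_cases j <;> simp)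
  have e : Sum.elim (fun _ => f) (algebraMap (Polynomial k) (PowerSeries k) ∘
      fun _ : Unit => Polynomial.X) ∘ (![.inr (), .inl ()] : Fin 2 → Unit ⊕ Unit) =
        ![PowerSeries.X, f] := by
    ext i
    fin_cases i <;> simp [PowerSeries.algebraMap_apply']
  rw [e] at this
  exact this

theorem coeff_inVar_mul_inVar (f g : PowerSeries k) (d : Fin 2 →₀ ℕ) :
    MvPowerSeries.coeff d (inVar 0 f * inVar 1 g) =
      PowerSeries.coeff (d 0) f * PowerSeries.coeff (d 1) g := by
  classical
  have hd : Finsupp.single 0 (d 0) + Finsupp.single 1 (d 1) = d := by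
    ext i
    fin_cases i <;> simp
  rw [MvPowerSeries.coeff_mul,
    Finset.sum_eq_single (Finsupp.single 0 (d 0), Finsupp.single 1 (d 1))]
  · rw [coeff_single_inVar_self, coeff_single_inVar_self]
  · rintro ⟨a, b⟩ hab hne
    rw [Finset.HasAntidiagonal.mem_antidiagonal] at hab
    simp only [coeff_inVar]
    split_ifs with h1 h2
    · refine absurd ?_ hne
      have h0 : a 0 = d 0 := by
        rw [← hab, Finsupp.add_apply, ← h2]
        simp
      have h1' : b 1 = d 1 := by
        rw [← hab, Finsupp.add_apply, ← h1]
        simp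
      rw [← h1, ← h2, h0, h1']
    all_goals simp
  · intro h
    exact absurd (Finset.HasAntidiagonal.mem_antidiagonal.2 hd) h

/-- Polynomials in `y` and `τ` over the ring of polynomials in `x` and `σ`, the variables being
independent. -/
abbrev Poly4 (k : Type*) [Field k] : Type _ := MvPolynomial (Fin 2) (MvPolynomial (Fin 2) k)

variable (σ τ : PowerSeries k)

/-- Evaluation of polynomials in four variables at `x, σ, y, τ`. -/
def evalPoly4 : Poly4 k →+* PS k :=
  MvPolynomial.eval₂Hom ((inVarHom 0).comp (aevalX σ)).toRingHom ![MvPowerSeries.X 1, inVar 1 τ]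

theorem evalPoly4_C (c : MvPolynomial (Fin 2) k) :
    evalPoly4 σ τ (MvPolynomial.C c) = inVar 0 (aevalX σ c) := by
  simp [evalPoly4, inVarHom_apply]

theorem evalPoly4_map_C (q : MvPolynomial (Fin 2) k) :
    evalPoly4 σ τ (MvPolynomial.map MvPolynomial.C q) = inVar 1 (aevalX τ q) := by
  induction q using MvPolynomial.induction_on with
  | C r =>
    rw [MvPolynomial.map_C, evalPoly4_C, ← MvPolynomial.algebraMap_eq, AlgHom.commutes,
      AlgHom.commutes, inVar_algebraMap, inVar_algebraMap]
  | add p q hp hq => rw [map_add, map_add, map_add, inVar_add, hp, hq]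
  | mul_X p i hp =>
    rw [map_mul, map_mul, map_mul, inVar_mul, hp]
    congr 1
    fin_cases i <;> simp [evalPoly4, aevalX, inVar_X]

variable {σ τ} in
/-- `x`, `y`, `σ` and `τ` are algebraically independent over `k`. -/
theorem evalPoly4_injective (hσ : Transcendental (Polynomial k) σ)
    (hτ : Transcendental (Polynomial k) τ) : Function.Injective (evalPoly4 σ τ) := by
  rw [injective_iff_map_eq_zero]
  intro p hp
  have e : evalPoly4 σ τ p = ∑ m ∈ p.support, inVar 0 (aevalX σ (p.coeff m)) *
      inVar 1 (aevalX τ (MvPolynomial.monomial m 1)) := by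
    conv_lhs => rw [p.as_sum]
    rw [map_sum]
    refine Finset.sum_congr rfl fun m _ => ?_
    rw [← evalPoly4_C σ τ, ← evalPoly4_map_C σ τ, ← map_mul, MvPolynomial.map_monomial, map_one,
      MvPolynomial.C_mul_monomial, mul_one]
  -- the coefficient of each power of `x` is a polynomial relation between `y` and `τ`
  have key : ∀ i : ℕ, ∑ m ∈ p.support,
      MvPolynomial.monomial m (PowerSeries.coeff i (aevalX σ (p.coeff m))) = 0 := by
    intro i
    refine aevalX_injective hτ ?_
    ext j
    rw [map_zero, map_zero, map_sum, map_sum]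
    have h := congrArg (MvPowerSeries.coeff (Finsupp.single 0 i + Finsupp.single 1 j))
      (e.symm.trans hp)
    rw [map_sum, map_zero] at h
    rw [← h]
    refine Finset.sum_congr rfl fun m _ => ?_
    rw [coeff_inVar_mul_inVar, ← mul_one (PowerSeries.coeff i _), ← MvPolynomial.C_mul_monomial,
      ← MvPolynomial.algebraMap_eq, map_mul, AlgHom.commutes]
    simp
  ext1 m
  rw [MvPolynomial.coeff_zero]
  by_contra hm
  refine hm (aevalX_injective hσ ?_)
  ext i
  have h := congrArg (MvPolynomial.coeff m) (key i)
  rw [MvPolynomial.coeff_sum, MvPolynomial.coeff_zero] at h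
  simp only [MvPolynomial.coeff_monomial] at h
  rw [Finset.sum_ite_eq' , if_pos (MvPolynomial.mem_support_iff.2 hm)] at h
  rw [h, map_zero, map_zero]

theorem X_mem_range_evalPoly4 (i : Fin 2) : MvPowerSeries.X i ∈ (evalPoly4 σ τ).range := by
  fin_cases i
  · exact ⟨MvPolynomial.C (MvPolynomial.X 0), by
      rw [evalPoly4_C]
      simp [aevalX, inVar_X]⟩
  · exact ⟨MvPolynomial.X 0, by simp [evalPoly4]⟩

theorem inVar_mem_range_evalPoly4 (i : Fin 2) :
    inVar i (![σ, τ] i) ∈ (evalPoly4 σ τ).range := by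
  fin_cases i
  · exact ⟨MvPolynomial.C (MvPolynomial.X 1), by
      rw [evalPoly4_C]
      simp [aevalX]⟩
  · exact ⟨MvPolynomial.X 1, by simp [evalPoly4]⟩

variable {σ τ} (hσ0 : PowerSeries.constantCoeff σ = 0) (hτ0 : PowerSeries.constantCoeff τ = 0)

include hσ0 hτ0

theorem inVar_mem_Un_zero (i : Fin 2) : inVar i (![σ, τ] i) ∈ Un σ τ 0 := by
  have h := inVar_endpiece_mem_Un σ τ 0 i
  rwa [endpiece_zero (by fin_cases i <;> simp [hσ0, hτ0])] at h

theorem evalPoly4_mem_U (p : Poly4 k) : evalPoly4 σ τ p ∈ U σ τ := by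
  have h0 : ∀ c, inVar 0 (aevalX σ c) ∈ Un σ τ 0 := fun c => by
    induction c using MvPolynomial.induction_on with
    | C r =>
      rw [← MvPolynomial.algebraMap_eq, AlgHom.commutes, inVar_algebraMap]
      exact Subalgebra.algebraMap_mem _ _
    | add p q hp hq =>
      rw [map_add, inVar_add]
      exact add_mem hp hq
    | mul_X p i hp =>
      rw [map_mul, inVar_mul]
      refine mul_mem hp ?_
      fin_cases i
      · simpa [aevalX, inVar_X] using X_mem_Un σ τ 0 0
      · simpa [aevalX] using inVar_mem_Un_zero hσ0 hτ0 0
  refine Un_le_U σ τ 0 ?_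
  induction p using MvPolynomial.induction_on with
  | C c =>
    rw [evalPoly4_C]
    exact h0 c
  | add p q hp hq =>
    rw [map_add]
    exact add_mem hp hq
  | mul_X p i hp =>
    rw [map_mul]
    refine mul_mem hp ?_
    fin_cases i
    · simpa [evalPoly4] using X_mem_Un σ τ 0 1
    · simpa [evalPoly4] using inVar_mem_Un_zero hσ0 hτ0 1

/-- After multiplication by a power of `x * y`, every element of `U` is a polynomial in
`x, σ, y, τ`. -/
theorem exists_evalPoly4_eq {f : PS k} (hf : f ∈ U σ τ) :
    ∃ N p, evalPoly4 σ τ p = MvPowerSeries.X 0 ^ N * MvPowerSeries.X 1 ^ N * f := by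
  set W : ℕ → PS k := fun N => MvPowerSeries.X 0 ^ N * MvPowerSeries.X 1 ^ N with hW
  have hWmem : ∀ N, W N ∈ (evalPoly4 σ τ).range := fun N =>
    mul_mem (pow_mem (X_mem_range_evalPoly4 σ τ 0) N) (pow_mem (X_mem_range_evalPoly4 σ τ 1) N)
  have hWadd : ∀ M N, W (M + N) = W M * W N := fun M N => by
    simp only [hW]
    ring
  suffices ∃ N, W N * f ∈ (evalPoly4 σ τ).range by
    obtain ⟨N, p, hp⟩ := this
    exact ⟨N, p, hp⟩
  have halg : ∀ r, algebraMap k (PS k) r ∈ (evalPoly4 σ τ).range := fun r =>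
    ⟨MvPolynomial.C (MvPolynomial.C r), by
      rw [evalPoly4_C, ← MvPolynomial.algebraMap_eq, AlgHom.commutes, inVar_algebraMap]⟩
  have hend : ∀ n (i : Fin 2), MvPowerSeries.X i ^ n * inVar i (endpiece (![σ, τ] i) n) ∈
      (evalPoly4 σ τ).range := fun n i => by
    induction n with
    | zero =>
      rw [pow_zero, one_mul, endpiece_zero (by fin_cases i <;> simp [hσ0, hτ0])]
      exact inVar_mem_range_evalPoly4 σ τ i
    | succ n ih =>
      rw [inVar_endpiece_succ] at ih
      have h2 := sub_mem ih (mul_mem (pow_mem (X_mem_range_evalPoly4 σ τ i) n)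
        (mul_mem (halg (PowerSeries.coeff (n + 1) (![σ, τ] i))) (X_mem_range_evalPoly4 σ τ i)))
      convert h2 using 1
      ring
  obtain ⟨n, -, hn⟩ := (mem_U_iff σ τ f).1 hf
  clear hf
  induction hn using Algebra.adjoin_induction with
  | mem f hf =>
    obtain ⟨i, rfl | rfl⟩ := (mem_gens_iff σ τ n f).1 hf
    · exact ⟨0, mul_mem (hWmem 0) (X_mem_range_evalPoly4 σ τ i)⟩
    · refine ⟨n, ?_⟩
      have : ∃ l : Fin 2, W n = MvPowerSeries.X l ^ n * MvPowerSeries.X i ^ n := by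
        fin_cases i
        · exact ⟨1, mul_comm _ _⟩
        · exact ⟨0, rfl⟩
      obtain ⟨l, hl⟩ := this
      rw [hl, mul_assoc]
      exact mul_mem (pow_mem (X_mem_range_evalPoly4 σ τ l) n) (hend n i)
  | algebraMap r => exact ⟨0, mul_mem (hWmem 0) (halg r)⟩
  | add f g _ _ hf hg =>
    obtain ⟨M, hM⟩ := hf
    obtain ⟨N, hN⟩ := hg
    refine ⟨M + N, ?_⟩
    convert add_mem (mul_mem (hWmem N) hM) (mul_mem (hWmem M) hN) using 1
    rw [hWadd]
    ring
  | mul f g _ _ hf hg =>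
    obtain ⟨M, hM⟩ := hf
    obtain ⟨N, hN⟩ := hg
    refine ⟨M + N, ?_⟩
    convert mul_mem hM hN using 1
    rw [hWadd]
    ring

/-- Every element of `B` is a fraction `t / s` of polynomials in `x, σ, y, τ`, where `s` is a unit
of `B` times a power of `x * y`. -/
theorem exists_evalPoly4_eq_mul {f : PS k} (hf : f ∈ B σ τ) :
    ∃ s t N, ∃ u ∈ U σ τ, MvPowerSeries.constantCoeff u ≠ 0 ∧
      evalPoly4 σ τ s = MvPowerSeries.X 0 ^ N * MvPowerSeries.X 1 ^ N * u ∧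
      evalPoly4 σ τ t = evalPoly4 σ τ s * f := by
  obtain ⟨u, hu, hu0, huf⟩ := (mem_B_iff_exists_mem_U σ τ f).1 hf
  obtain ⟨M, s, hs⟩ := exists_evalPoly4_eq hσ0 hτ0 hu
  obtain ⟨N, t, ht⟩ := exists_evalPoly4_eq hσ0 hτ0 huf
  obtain ⟨a, ha⟩ := X_mem_range_evalPoly4 σ τ 0
  obtain ⟨b, hb⟩ := X_mem_range_evalPoly4 σ τ 1
  refine ⟨a ^ N * b ^ N * s, a ^ M * b ^ M * t, M + N, u, hu, hu0, ?_, ?_⟩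
  · simp only [map_mul, map_pow, ha, hb, hs]
    ring
  · simp only [map_mul, map_pow, ha, hb, hs, ht]
    ring

variable (hσ : Transcendental (Polynomial k) σ) (hτ : Transcendental (Polynomial k) τ)

/-- Evaluation of polynomials at `x, σ, y, τ`, as a homomorphism to `B`. -/
def evalB : Poly4 k →+* B σ τ :=
  (evalPoly4 σ τ).codRestrict _ fun p => U_le_B σ τ (evalPoly4_mem_U hσ0 hτ0 p)

theorem coe_evalB (p : Poly4 k) : (evalB hσ0 hτ0 p : PS k) = evalPoly4 σ τ p := rfl

theorem exists_evalB_eq_mul (f : B σ τ) :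
    ∃ s t N, Associated (evalB hσ0 hτ0 s)
      ((isLocalEdgeClosed_B σ τ).var 0 ^ N * (isLocalEdgeClosed_B σ τ).var 1 ^ N) ∧
      evalB hσ0 hτ0 t = evalB hσ0 hτ0 s * f := by
  obtain ⟨s, t, N, u, hu, hu0, hs, ht⟩ := exists_evalPoly4_eq_mul hσ0 hτ0 f.2
  have hu' : IsUnit (⟨u, U_le_B σ τ hu⟩ : B σ τ) :=
    ((isLocalEdgeClosed_B σ τ).isUnit_iff _).2 hu0
  exact ⟨s, t, N, Associated.symm ⟨hu'.unit, Subtype.ext hs.symm⟩, Subtype.ext ht⟩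

include hσ hτ

theorem uniqueFactorizationMonoid_B : UniqueFactorizationMonoid (B σ τ) := by
  have hB := isLocalEdgeClosed_B σ τ
  obtain ⟨x, hx⟩ := X_mem_range_evalPoly4 σ τ 0
  obtain ⟨y, hy⟩ := X_mem_range_evalPoly4 σ τ 1
  have hx : evalB hσ0 hτ0 x = hB.var 0 := Subtype.ext hx
  have hy : evalB hσ0 hτ0 y = hB.var 1 := Subtype.ext hy
  refine uniqueFactorizationMonoid_of_prime_of_prime (evalB hσ0 hτ0) (x := x) (y := y)
    (fun p q h => evalPoly4_injective hσ hτ (congrArg Subtype.val h)) ?_ ?_ ?_ ?_ ?_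
  · exact hx ▸ hB.var_prime 0
  · exact hy ▸ hB.var_prime 1
  · rw [hx]
    exact fun f => hB.exists_eq_var_pow_mul 0
  · rw [hy]
    exact fun f => hB.exists_eq_var_pow_mul 1
  · rw [hx, hy]
    exact exists_evalB_eq_mul hσ0 hτ0

theorem uniqueFactorizationMonoid_U : UniqueFactorizationMonoid (U σ τ) := by
  have hU := isEdgeClosed_U σ τ
  let φ : Poly4 k →+* U σ τ := (evalPoly4 σ τ).codRestrict _ (evalPoly4_mem_U hσ0 hτ0)
  obtain ⟨x, hx⟩ := X_mem_range_evalPoly4 σ τ 0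
  obtain ⟨y, hy⟩ := X_mem_range_evalPoly4 σ τ 1
  have hx : φ x = hU.var 0 := Subtype.ext hx
  have hy : φ y = hU.var 1 := Subtype.ext hy
  refine uniqueFactorizationMonoid_of_prime_of_prime φ (x := x) (y := y)
    (fun p q h => evalPoly4_injective hσ hτ (congrArg Subtype.val h)) ?_ ?_ ?_ ?_ ?_
  · exact hx ▸ hU.var_prime 0
  · exact hy ▸ hU.var_prime 1
  · rw [hx]
    exact fun f => hU.exists_eq_var_pow_mul 0
  · rw [hy]
    exact fun f => hU.exists_eq_var_pow_mul 1
  · intro f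
    obtain ⟨N, p, hp⟩ := exists_evalPoly4_eq hσ0 hτ0 f.2
    refine ⟨x ^ N * y ^ N, p, N, by simp, ?_⟩
    rw [map_mul, map_pow, map_pow, hx, hy]
    exact Subtype.ext hp

end

/-! ### Heights of prime ideals -/

section

/-- A prime ideal of a polynomial ring in `n` variables over a domain that contains no nonzero
constant has height at most `n`, since it survives in the polynomial ring over the field of
fractions. -/
theorem height_le_of_comap_C_eq_bot {R : Type*} [CommRing R] [IsDomain R] {n : ℕ}
    (P : Ideal (MvPolynomial (Fin n) R)) [hP : P.IsPrime]
    (h : ∀ r : R, r ≠ 0 → MvPolynomial.C r ∉ P) : P.height ≤ n := by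
  let K := FractionRing R
  let := MvPolynomial.algebraMvPolynomial (σ := Fin n) (R := R) (S := K)
  have hloc := MvPolynomial.isLocalization (σ := Fin n) (nonZeroDivisors R) K
  have hdisj : Disjoint
      (((nonZeroDivisors R).map MvPolynomial.C : Submonoid (MvPolynomial (Fin n) R)) :
        Set (MvPolynomial (Fin n) R))
      (P : Set (MvPolynomial (Fin n) R)) := by
    rw [Set.disjoint_left]
    rintro _ ⟨r, hr, rfl⟩ hrP
    exact h r (nonZeroDivisors.ne_zero hr) hrP
  have hprime := IsLocalization.isPrime_of_isPrime_disjoint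
    ((nonZeroDivisors R).map MvPolynomial.C) (MvPolynomial (Fin n) K) P hP hdisj
  rw [← IsLocalization.height_map_of_disjoint (S := MvPolynomial (Fin n) K)
    ((nonZeroDivisors R).map MvPolynomial.C) P hdisj]
  have h1 := Ideal.height_le_ringKrullDim_of_ne_top hprime.ne_top
  rw [MvPolynomial.ringKrullDim_of_isNoetherianRing, ringKrullDim_eq_zero_of_field, zero_add,
    Nat.card_fin] at h1
  exact_mod_cast h1

theorem comap_lt_comap_of_lt {T R : Type*} [CommRing T] [CommRing R] (φ : T →+* R) {P Q : Ideal R}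
    [hQ : Q.IsPrime] (hQP : Q < P) (h : ∀ b : R, ∃ s t, φ s ∉ P ∧ φ t = φ s * b) :
    Q.comap φ < P.comap φ := by
  refine lt_of_le_not_ge (Ideal.comap_mono hQP.le) fun hge => ?_
  obtain ⟨b, hbP, hbQ⟩ := SetLike.exists_of_lt hQP
  obtain ⟨s, t, hs, ht⟩ := h b
  have ht' : t ∈ P.comap φ := by
    rw [Ideal.mem_comap, ht]
    exact P.mul_mem_left _ hbP
  have htQ : φ t ∈ Q := hge ht'
  rw [ht] at htQ
  exact (hQ.mem_or_mem htQ).elim (fun h' => hs (hQP.le h')) hbQ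

/-- Heights do not drop under contraction along a homomorphism that is a localization outside
`P`. -/
theorem height_le_of_height_comap_le {T R : Type*} [CommRing T] [CommRing R] (φ : T →+* R) (n : ℕ)
    (P : Ideal R) [hP : P.IsPrime] (h : ∀ b : R, ∃ s t, φ s ∉ P ∧ φ t = φ s * b)
    (hn : (P.comap φ).height ≤ n) : P.height ≤ n := by
  induction n generalizing P with
  | zero =>
    rw [Ideal.height_le_iff] at hn ⊢
    intro q hq hqP
    refine absurd (hn (q.comap φ) inferInstance (comap_lt_comap_of_lt φ hqP h)) (by simp)
  | succ n ih =>
    rw [Ideal.height_le_iff] at hn ⊢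
    intro q hq hqP
    have h1 := hn (q.comap φ) inferInstance (comap_lt_comap_of_lt φ hqP h)
    rw [Nat.cast_add, Nat.cast_one, ENat.lt_add_one_iff (ENat.natCast_ne_top n)] at h1 ⊢
    refine ih q (fun b => ?_) h1
    obtain ⟨s, t, hs, ht⟩ := h b
    exact ⟨s, t, fun h' => hs (hqP.le h'), ht⟩

namespace IsLocalEdgeClosed

variable {k : Type*} [Field k] {S : Subalgebra k (PS k)} (hS : IsLocalEdgeClosed S)

include hS

theorem eq_bot_of_lt_span_var {P : Ideal S} (hP : P.IsPrime) {i : Fin 2}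
    (h : P < Ideal.span {hS.var i}) : P = ⊥ := by
  rw [Submodule.eq_bot_iff]
  intro f hf
  by_contra hf0
  obtain ⟨n, g, rfl, hg⟩ := hS.exists_eq_var_pow_mul i hf0
  rcases hP.mem_or_mem hf with h' | h'
  · exact h.not_ge ((Ideal.span_singleton_le_iff_mem _).2 (hP.mem_of_pow_mem n h'))
  · exact hg (Ideal.mem_span_singleton.1 (h.le h'))

theorem height_span_var_le (i : Fin 2) : (Ideal.span {hS.var i}).height ≤ 1 := by
  have := hS.span_var_isPrime i
  rw [← Nat.cast_one, Ideal.height_le_iff]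
  intro q hq hlt
  rw [hS.eq_bot_of_lt_span_var hq hlt, Ideal.height_bot]
  simp

/-- Only the primes that contain no variable matter for the dimension. -/
theorem ringKrullDim_le {n : ℕ} (hn : 1 ≤ n)
    (h : ∀ P : Ideal S, P.IsPrime → hS.var 0 ∉ P → hS.var 1 ∉ P → P.height ≤ n) :
    ringKrullDim S ≤ n + 1 := by
  have := hS.isLocalRing
  rw [← IsLocalRing.maximalIdeal_height_eq_ringKrullDim]
  suffices (IsLocalRing.maximalIdeal S).height ≤ (n + 1 : ℕ) by exact_mod_cast this
  rw [Ideal.height_le_iff]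
  intro q hq hlt
  rw [Nat.cast_add, Nat.cast_one, ENat.lt_add_one_iff (ENat.natCast_ne_top n)]
  by_cases hx : ∃ i, hS.var i ∈ q
  · obtain ⟨i, hi⟩ := hx
    rcases hS.eq_span_or_eq_of_var_mem hq hi with rfl | rfl
    · exact (hS.height_span_var_le i).trans (by exact_mod_cast hn)
    · exact absurd hS.maximalIdeal_eq hlt.ne'
  · push Not at hx
    exact h q hq (hx 0) (hx 1)

/-- A prime that does not contain the variable `X i` contains no nonzero power series in `X i`. -/
theorem notMem_of_eq_inVar {P : Ideal S} (hP : P.IsPrime) {i : Fin 2} (hi : hS.var i ∉ P) {f : S}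
    {g : PowerSeries k} (hg : g ≠ 0) (hf : (f : PS k) = inVar i g) : f ∉ P := by
  intro hfP
  obtain ⟨n, u, hu, hu0⟩ := hS.toIsEdgeClosed.exists_inVar_eq hg (hf ▸ f.2)
  have : f = hS.var i ^ n * u := Subtype.ext (hf.trans hu)
  exact hi (hP.mem_of_pow_mem n (hS.mem_of_mul_mem_of_constantCoeff_ne_zero hu0 (this ▸ hfP)))

end IsLocalEdgeClosed

variable {k : Type*} [Field k] {σ τ : PowerSeries k}
  (hσ0 : PowerSeries.constantCoeff σ = 0) (hτ0 : PowerSeries.constantCoeff τ = 0)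

/-- If the prime `P` contains no variable, then the elements of `B` are fractions of polynomials in
`x, σ, y, τ` with denominators outside `P`. -/
theorem exists_evalB_notMem (P : Ideal (B σ τ)) (hP : P.IsPrime)
    (hx : (isLocalEdgeClosed_B σ τ).var 0 ∉ P) (hy : (isLocalEdgeClosed_B σ τ).var 1 ∉ P)
    (b : B σ τ) :
    ∃ s t, evalB hσ0 hτ0 s ∉ P ∧ evalB hσ0 hτ0 t = evalB hσ0 hτ0 s * b := by
  obtain ⟨s, t, N, hs, ht⟩ := exists_evalB_eq_mul hσ0 hτ0 b
  refine ⟨s, t, fun h => ?_, ht⟩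
  rcases hP.mem_or_mem (P.mem_of_dvd hs.dvd h) with h | h
  exacts [hx (hP.mem_of_pow_mem _ h), hy (hP.mem_of_pow_mem _ h)]

/-- Nonzero polynomials in `x` and `σ` are power series in `x` alone. -/
theorem evalB_C_notMem (hσ : Transcendental (Polynomial k) σ) (P : Ideal (B σ τ)) (hP : P.IsPrime)
    (hx : (isLocalEdgeClosed_B σ τ).var 0 ∉ P) {r : MvPolynomial (Fin 2) k} (hr : r ≠ 0) :
    evalB hσ0 hτ0 (MvPolynomial.C r) ∉ P :=
  (isLocalEdgeClosed_B σ τ).notMem_of_eq_inVar hP hx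
    ((map_ne_zero_iff _ (aevalX_injective hσ)).2 hr) (evalPoly4_C σ τ r)

include hσ0 hτ0 in
theorem ringKrullDim_B_le_three (hσ : Transcendental (Polynomial k) σ) :
    ringKrullDim (B σ τ) ≤ 3 := by
  have hB := isLocalEdgeClosed_B σ τ
  refine (hB.ringKrullDim_le one_le_two fun P hP hx hy => ?_).trans (by norm_num)
  refine height_le_of_height_comap_le (evalB hσ0 hτ0) 2 P
    (exists_evalB_notMem hσ0 hτ0 P hP hx hy) ?_
  exact height_le_of_comap_C_eq_bot _ fun r hr => evalB_C_notMem hσ0 hτ0 hσ P hP hx hr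

end

/-! ### Closed ideals -/

section

theorem isClosed_adicTopology_iff {R : Type*} [CommRing R] (I J : Ideal R) :
    @IsClosed R I.adicTopology (J : Set R) ↔ ∀ b, (∀ n, b ∈ J ⊔ I ^ n) → b ∈ J := by
  let := I.adicTopology
  have key : ∀ b, b ∈ closure (J : Set R) ↔ ∀ n, b ∈ J ⊔ I ^ n := fun b => by
    rw [mem_closure_iff_nhds_basis (I.hasBasis_nhds_adic b)]
    constructor
    · intro h n
      obtain ⟨_, hy, z, hz, rfl⟩ := h n trivial
      rw [← add_sub_cancel_right b z]
      exact sub_mem (Ideal.mem_sup_left hy) (Ideal.mem_sup_right hz)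
    · intro h n _
      obtain ⟨y, hy, z, hz, rfl⟩ := Submodule.mem_sup.1 (h n)
      exact ⟨y, hy, -z, neg_mem hz, by simp⟩
  rw [← closure_subset_iff_isClosed]
  simp only [Set.subset_def, key, SetLike.mem_coe]

/-- Krull's intersection theorem: in a Noetherian local ring all ideals are closed. -/
theorem isClosed_adicTopology_of_isNoetherianRing {R : Type*} [CommRing R] [IsNoetherianRing R]
    [IsLocalRing R] (J : Ideal R) :
    @IsClosed R (IsLocalRing.maximalIdeal R).adicTopology (J : Set R) := by
  rw [isClosed_adicTopology_iff]
  intro b hb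
  have h := Ideal.iInf_pow_smul_eq_bot_of_isLocalRing (M := R ⧸ J) (IsLocalRing.maximalIdeal R)
    (IsLocalRing.maximalIdeal.isMaximal R).ne_top
  rw [← Ideal.Quotient.eq_zero_iff_mem, ← Submodule.mem_bot R, ← h, Submodule.mem_iInf]
  intro n
  obtain ⟨y, hy, z, hz, rfl⟩ := Submodule.mem_sup.1 (hb n)
  rw [map_add, Ideal.Quotient.eq_zero_iff_mem.2 hy, zero_add, ← mul_one z]
  exact Submodule.smul_mem_smul hz (Submodule.mem_top (x := (1 : R ⧸ J)))

variable {k : Type*} [Field k] {σ τ : PowerSeries k}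
  (hσ0 : PowerSeries.constantCoeff σ = 0) (hτ0 : PowerSeries.constantCoeff τ = 0)

theorem idealB_eq : idealB σ τ =
    Ideal.span {(isLocalEdgeClosed_B σ τ).var 0, (isLocalEdgeClosed_B σ τ).var 1} := rfl

theorem t2Space_adicTopology_B : @T2Space (B σ τ) (idealB σ τ).adicTopology := by
  let := (idealB σ τ).adicTopology
  exact (IsAdic.isHausdorff_iff (I := idealB σ τ) rfl).1 (isLocalEdgeClosed_B σ τ).isHausdorff

include hσ0 hτ0

theorem isNoetherianRing_A : IsNoetherianRing (A σ τ) :=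
  (isLocalEdgeClosed_A hσ0 hτ0).isNoetherianRing fun hb hb0 h => mem_A_of_mul_mem σ τ hb hb0 h

/-- The closure of `bB` is `B ∩ b k[[x, y]]`, which contains `b * f` for every `f` of `A` with
denominator `b`. -/
theorem B_eq_A_of_isClosed (h : ∀ b : B σ τ,
    @IsClosed _ (idealB σ τ).adicTopology (Ideal.span {b} : Set (B σ τ))) : B σ τ = A σ τ := by
  have hB := isLocalEdgeClosed_B σ τ
  refine le_antisymm (B_le_A hσ0 hτ0) fun f hf => ?_
  obtain ⟨a, ha, b, hb, hb0, e⟩ := (birationallyDominates hσ0 hτ0).exists_fraction f hf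
  have hmem : (⟨a, ha⟩ : B σ τ) ∈ Ideal.span {(⟨b, hb⟩ : B σ τ)} := by
    refine (isClosed_adicTopology_iff _ _).1 (h ⟨b, hb⟩) _ fun n => ?_
    obtain ⟨g, hg⟩ := hB.exists_sub_mem_orderIdeal n f
    refine Submodule.mem_sup.2 ⟨⟨b, hb⟩ * g,
      Ideal.mul_mem_right _ _ (Ideal.mem_span_singleton_self _), ⟨a, ha⟩ - ⟨b, hb⟩ * g, ?_, by ring⟩
    rw [idealB_eq, hB.mem_span_pow_iff]
    convert Ideal.mul_mem_left _ b hg using 1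
    rw [mul_sub, e]
    rfl
  obtain ⟨c, hc⟩ := Ideal.mem_span_singleton.1 hmem
  have hc : a = b * c := congrArg Subtype.val hc
  rw [mul_left_cancel₀ hb0 (e.trans hc)]
  exact c.2

theorem tfae_B_eq_A : [ B σ τ = A σ τ,
        IsRegularLocalRing (B σ τ) ∧ ringKrullDim (B σ τ) = 2,
        IsNoetherianRing (B σ τ),
        ∀ I : Ideal (B σ τ), I.FG →
          @IsClosed _ (idealB σ τ).adicTopology (I : Set (B σ τ)),
        ∀ b : B σ τ,
          @IsClosed _ (idealB σ τ).adicTopology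
            (Ideal.span {b} : Set (B σ τ)) ].TFAE := by
  have hA := isLocalEdgeClosed_A hσ0 hτ0
  have hB := isLocalEdgeClosed_B σ τ
  tfae_have 1 → 2 := by
    intro h
    have := isNoetherianRing_A hσ0 hτ0
    rw [h]
    exact ⟨hA.isRegularLocalRing, hA.ringKrullDim_eq_two⟩
  tfae_have 2 → 3 := fun h => by
    have := h.1
    infer_instance
  tfae_have 3 → 4 := by
    intro h I _
    have := hB.isLocalRing
    rw [idealB_eq, ← hB.maximalIdeal_eq]
    exact isClosed_adicTopology_of_isNoetherianRing I
  tfae_have 4 → 5 := fun h b => h _ (Submodule.fg_span_singleton b)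
  tfae_have 5 → 1 := B_eq_A_of_isClosed hσ0 hτ0
  tfae_finish

theorem ringKrullDim_B_eq_two_or_three (hσ : Transcendental (Polynomial k) σ) :
    ringKrullDim (B σ τ) = 2 ∨ ringKrullDim (B σ τ) = 3 := by
  have h1 := (isLocalEdgeClosed_B σ τ).two_le_ringKrullDim
  have h2 := ringKrullDim_B_le_three hσ0 hτ0 hσ
  revert h1 h2
  generalize ringKrullDim (B σ τ) = d
  intro h1 h2
  induction d using WithBot.recBotCoe with
  | bot => exact absurd h1 (by decide)
  | coe d =>
    induction d using ENat.recTopCoe with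
    | top => exact absurd h2 (by decide)
    | coe d =>
      have h1' : 2 ≤ d := (Nat.cast_le (α := WithBot ℕ∞)).1 h1
      have h2' : d ≤ 3 := (Nat.cast_le (α := WithBot ℕ∞)).1 h2
      interval_cases d
      exacts [.inl rfl, .inr rfl]

end

/-! ### Lacunary power series -/

section

variable {k : Type*} [Field k]

/-- The lacunary power series `∑ X ^ N i`, for a strictly increasing sequence `N`. -/
def lacunary (k : Type*) [Field k] (N : ℕ → ℕ) : PowerSeries k :=
  open scoped Classical in PowerSeries.mk fun j => if j ∈ Set.range N then 1 else 0

/-- The partial sum `∑_{i ≤ n} X ^ N i`. -/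
def lacunarySum (k : Type*) [Field k] (N : ℕ → ℕ) (n : ℕ) : Polynomial k :=
  ∑ i ∈ Finset.range (n + 1), Polynomial.X ^ N i

section

variable {N : ℕ → ℕ} (hN : StrictMono N)

include hN

theorem coeff_lacunarySum (n j : ℕ) :
    open scoped Classical in (lacunarySum k N n).coeff j = if ∃ i ≤ n, N i = j then 1 else 0 := by
  rw [lacunarySum, Polynomial.finsetSum_coeff]
  simp only [Polynomial.coeff_X_pow]
  split_ifs with h
  · obtain ⟨i, hi, rfl⟩ := h
    rw [Finset.sum_eq_single i]
    · simp
    · intro l _ hl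
      rw [if_neg (fun h => hl (hN.injective h.symm))]
    · intro h
      simp at h
      omega
  · refine Finset.sum_eq_zero fun i hi => if_neg fun h' => h ⟨i, ?_, h'.symm⟩
    simp at hi
    omega

theorem natDegree_lacunarySum_le (n : ℕ) : (lacunarySum k N n).natDegree ≤ N n := by
  classical
  rw [Polynomial.natDegree_le_iff_coeff_eq_zero]
  intro j hj
  rw [coeff_lacunarySum hN, if_neg]
  rintro ⟨i, hi, rfl⟩
  have := hN.monotone hi
  omega

theorem X_pow_dvd_lacunary_sub (n : ℕ) :
    (PowerSeries.X : PowerSeries k) ^ N (n + 1) ∣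
      lacunary k N - (lacunarySum k N n : PowerSeries k) := by
  classical
  rw [PowerSeries.X_pow_dvd_iff]
  intro j hj
  rw [map_sub, Polynomial.coeff_coe, coeff_lacunarySum hN, lacunary, PowerSeries.coeff_mk,
    sub_eq_zero]
  refine if_congr ⟨?_, ?_⟩ rfl rfl
  · rintro ⟨i, rfl⟩
    exact ⟨i, Nat.lt_succ_iff.1 (hN.lt_iff_lt.1 hj), rfl⟩
  · rintro ⟨i, _, rfl⟩
    exact ⟨i, rfl⟩

theorem lacunarySum_injective : Function.Injective (lacunarySum k N) := by
  classical
  intro m n h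
  by_contra hmn
  wlog hlt : m < n generalizing m n
  · exact this h.symm (Ne.symm hmn) (by omega)
  have h1 := congrArg (Polynomial.coeff · (N n)) h
  simp only [coeff_lacunarySum hN] at h1
  rw [if_neg, if_pos ⟨n, le_rfl, rfl⟩] at h1
  · exact zero_ne_one h1
  · rintro ⟨i, hi, hin⟩
    have := hN.injective hin
    omega

theorem constantCoeff_lacunary (h0 : 0 < N 0) : PowerSeries.constantCoeff (lacunary k N) = 0 := by
  classical
  rw [← PowerSeries.coeff_zero_eq_constantCoeff_apply, lacunary, PowerSeries.coeff_mk, if_neg]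
  rintro ⟨i, hi⟩
  have := hN.monotone (Nat.zero_le i)
  omega

theorem X_pow_dvd_coe_eval_lacunarySum {p : Polynomial (Polynomial k)}
    (hp : Polynomial.aeval (lacunary k N) p = 0) (n : ℕ) :
    (PowerSeries.X : PowerSeries k) ^ N (n + 1) ∣
      ((p.eval (lacunarySum k N n) : Polynomial k) : PowerSeries k) := by
  have e : ((p.eval (lacunarySum k N n) : Polynomial k) : PowerSeries k) =
      Polynomial.aeval ((lacunarySum k N n : Polynomial k) : PowerSeries k) p := by
    have := Polynomial.hom_eval₂ p (RingHom.id _) (Polynomial.coeToPowerSeries.ringHom (R := k))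
      (lacunarySum k N n)
    rw [Polynomial.eval₂_id] at this
    rw [Polynomial.aeval_def]
    exact this
  rw [e, ← sub_zero (Polynomial.aeval _ p), ← hp, ← neg_sub, dvd_neg]
  refine (X_pow_dvd_lacunary_sub hN n).trans ?_
  rw [Polynomial.aeval_def, Polynomial.aeval_def, Polynomial.eval₂_eq_eval_map,
    Polynomial.eval₂_eq_eval_map]
  exact Polynomial.sub_dvd_eval_sub _ _ _

/-- Liouville's argument: if the gaps grow fast enough, then all but finitely many partial sums are
roots of each polynomial that the series satisfies. -/
theorem transcendental_lacunary (h0 : 0 < N 0) (hgap : ∀ n, n * N n < N (n + 1)) :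
    Transcendental (Polynomial k) (lacunary k N) := by
  rw [transcendental_iff]
  intro p hp
  by_contra hp0
  let d := p.support.sup fun i => (p.coeff i).natDegree
  have hdeg : ∀ n, (p.eval (lacunarySum k N n)).natDegree ≤ d + p.natDegree * N n := fun n => by
    rw [Polynomial.eval_eq_sum]
    refine Polynomial.natDegree_sum_le_of_forall_le _ _ fun i hi => ?_
    refine Polynomial.natDegree_mul_le.trans
      (add_le_add (Finset.le_sup (f := fun i => (p.coeff i).natDegree) hi) ?_)
    exact Polynomial.natDegree_pow_le.trans (Nat.mul_le_mul
      (Polynomial.le_natDegree_of_mem_supp i hi) (natDegree_lacunarySum_le hN n))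
  have hroot : ∀ n, d + p.natDegree ≤ n → p.IsRoot (lacunarySum k N n) := fun n hn => by
    have hpos : 1 ≤ N n := h0.trans_le (hN.monotone (Nat.zero_le n))
    have hlt : d + p.natDegree * N n < N (n + 1) := by
      -- the hypothesis `d + p.natDegree ≤ n` enters here, with `d ≤ d * N n`
      refine lt_of_le_of_lt ?_ (hgap n)
      nlinarith [Nat.mul_le_mul_right (N n) hn, Nat.mul_le_mul_left d hpos]
    ext j
    rw [Polynomial.coeff_zero]
    by_cases hj : j < N (n + 1)
    · rw [← Polynomial.coeff_coe]
      exact PowerSeries.X_pow_dvd_iff.1 (X_pow_dvd_coe_eval_lacunarySum hN hp n) j hj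
    · exact Polynomial.coeff_eq_zero_of_natDegree_lt (by have := hdeg n; omega)
  refine hp0 (Polynomial.eq_zero_of_infinite_isRoot p ?_)
  refine ((Set.Ici_infinite (d + p.natDegree)).image
    (lacunarySum_injective (k := k) hN).injOn).mono ?_
  rintro _ ⟨n, hn, rfl⟩
  exact hroot n hn

end

theorem isTranscendentalPair_of_transcendental {σ τ : PowerSeries k}
    (hσ0 : PowerSeries.constantCoeff σ = 0) (hτ0 : PowerSeries.constantCoeff τ = 0)
    (hσ : Transcendental (Polynomial k) σ) (hτ : Transcendental (Polynomial k) τ) :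
    IsTranscendentalPair σ τ where
  constantCoeff_left := hσ0
  constantCoeff_right := hτ0
  transcendental_left := (transcendental_coe_laurentSeries_iff σ).2 hσ
  transcendental_right := (transcendental_coe_laurentSeries_iff τ).2 hτ

theorem exists_transcendental (k : Type*) [Field k] :
    ∃ σ : PowerSeries k, PowerSeries.constantCoeff σ = 0 ∧ Transcendental (Polynomial k) σ := by
  have hN : StrictMono fun n : ℕ => (n + 1).factorial := strictMono_nat_of_lt_succ fun n =>
    (Nat.factorial_lt (by omega)).2 (by omega)
  refine ⟨lacunary k fun n => (n + 1).factorial, constantCoeff_lacunary hN (by simp),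
    transcendental_lacunary hN (by simp) fun n => ?_⟩
  rw [Nat.factorial_succ (n + 1)]
  exact Nat.mul_lt_mul_of_pos_right (by omega) (Nat.factorial_pos _)

/-! ### Dimension three -/

theorem hasSubst_diag : MvPowerSeries.HasSubst
    (fun _ : Fin 2 => (PowerSeries.X : MvPowerSeries Unit k)) :=
  MvPowerSeries.hasSubst_of_constantCoeff_zero fun _ => by simp [PowerSeries.X]

/-- The restriction of a power series in two variables to the diagonal `x = y`. -/
def diag : PS k →ₐ[k] PowerSeries k := MvPowerSeries.substAlgHom hasSubst_diag

theorem diag_X (i : Fin 2) : diag (MvPowerSeries.X i : PS k) = PowerSeries.X :=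
  MvPowerSeries.substAlgHom_X hasSubst_diag i

theorem diag_inVar (i : Fin 2) (f : PowerSeries k) : diag (inVar i f) = f := by
  rw [diag, MvPowerSeries.coe_substAlgHom, inVar, PowerSeries.subst,
    MvPowerSeries.subst_comp_subst_apply (PowerSeries.HasSubst.const (PowerSeries.HasSubst.X i))
      hasSubst_diag]
  simp only [MvPowerSeries.subst_X hasSubst_diag]
  exact PowerSeries.X_subst f

theorem constantCoeff_diag (f : PS k) :
    PowerSeries.constantCoeff (diag f) = MvPowerSeries.constantCoeff f := by
  have h := (isEdgeClosed_top (k := k).mem_span_iff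
    ⟨f - algebraMap k (PS k) (MvPowerSeries.constantCoeff f), Algebra.mem_top⟩).2 (by
      simp [MvPowerSeries.algebraMap_apply])
  obtain ⟨u, v, huv⟩ := Ideal.mem_span_pair.1 h
  have huv := congrArg Subtype.val huv
  simp only [Subalgebra.coe_add, Subalgebra.coe_mul, IsEdgeClosed.coe_var] at huv
  rw [sub_eq_iff_eq_add.1 huv.symm]
  simp only [map_add, map_mul, diag_X, AlgHom.commutes]
  simp [MvPowerSeries.algebraMap_apply]

/-- Setting `y = x` in polynomials in `x, σ, y, τ`. -/
def polyDiag (k : Type*) [Field k] : Poly4 k →+* Polynomial (MvPolynomial (Fin 2) k) :=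
  MvPolynomial.eval₂Hom Polynomial.C ![Polynomial.C (MvPolynomial.X 0), Polynomial.X]

theorem eval₂_polyDiag (σ τ : PowerSeries k) (p : Poly4 k) :
    (polyDiag k p).eval₂ (aevalX σ).toRingHom τ = diag (evalPoly4 σ τ p) := by
  suffices (Polynomial.eval₂RingHom (aevalX σ).toRingHom τ).comp (polyDiag k) =
      (diag (k := k)).toRingHom.comp (evalPoly4 σ τ) from congr($this p)
  refine MvPolynomial.ringHom_ext (fun r => ?_) fun i => ?_
  · simp [polyDiag, evalPoly4_C, diag_inVar]
  · fin_cases i <;> simp [polyDiag, evalPoly4, diag_inVar, diag_X, aevalX]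

section

variable {σ : PowerSeries k} (hσ0 : PowerSeries.constantCoeff σ = 0)
  (hσ : Transcendental (Polynomial k) σ)

include hσ0 in
theorem inVar_mem_B (i : Fin 2) : inVar i σ ∈ B σ σ := by
  have h := U_le_B σ σ (Un_le_U σ σ 0 (inVar_mem_Un_zero hσ0 hσ0 i))
  fin_cases i <;> simpa using h

include hσ in
/-- In `B`, the element `σ(x) - σ(y)` is not a multiple of `x - y`: in the polynomial ring in
`x, σ, y, τ` this would force a denominator to vanish on the diagonal `x = y`. -/
theorem not_sub_dvd_sub : ¬ (isLocalEdgeClosed_B σ σ).var 0 - (isLocalEdgeClosed_B σ σ).var 1 ∣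
    (⟨inVar 0 σ, inVar_mem_B hσ0 0⟩ - ⟨inVar 1 σ, inVar_mem_B hσ0 1⟩ : B σ σ) := by
  rintro ⟨c, hc⟩
  have hc : inVar 0 σ - inVar 1 σ = (MvPowerSeries.X 0 - MvPowerSeries.X 1) * (c : PS k) :=
    congrArg Subtype.val hc
  obtain ⟨s, t, N, u, hu, hu0, hs, ht⟩ := exists_evalPoly4_eq_mul hσ0 hσ0 c.2
  have e : (MvPolynomial.C (MvPolynomial.X 1) - MvPolynomial.X 1) * s =
      (MvPolynomial.C (MvPolynomial.X 0) - MvPolynomial.X 0) * t := by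
    apply evalPoly4_injective hσ hσ
    have h1 : evalPoly4 σ σ (MvPolynomial.C (MvPolynomial.X 1)) = inVar 0 σ := by
      rw [evalPoly4_C]
      simp [aevalX]
    have h2 : evalPoly4 σ σ (MvPolynomial.C (MvPolynomial.X 0)) = MvPowerSeries.X 0 := by
      rw [evalPoly4_C]
      simp [aevalX, inVar_X]
    have h3 : evalPoly4 σ σ (MvPolynomial.X 1) = inVar 1 σ := by simp [evalPoly4]
    have h4 : evalPoly4 σ σ (MvPolynomial.X 0) = MvPowerSeries.X 1 := by simp [evalPoly4]
    simp only [map_mul, map_sub, h1, h2, h3, h4, ht, hc]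
    ring
  have e' := congrArg (polyDiag k) e
  have hX : polyDiag k (MvPolynomial.C (MvPolynomial.X 0) - MvPolynomial.X 0) = 0 := by
    simp [polyDiag]
  have hY : polyDiag k (MvPolynomial.C (MvPolynomial.X 1) - MvPolynomial.X 1) ≠ 0 := by
    have : polyDiag k (MvPolynomial.C (MvPolynomial.X 1) - MvPolynomial.X 1) =
        -(Polynomial.X - Polynomial.C (MvPolynomial.X 1)) := by
      simp [polyDiag]
    rw [this, neg_ne_zero]
    exact Polynomial.X_sub_C_ne_zero _
  rw [map_mul, map_mul, hX, zero_mul] at e'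
  have h0 := eval₂_polyDiag σ σ s
  rw [(mul_eq_zero.1 e').resolve_left hY, Polynomial.eval₂_zero, hs, map_mul, map_mul, map_pow,
    map_pow, diag_X, diag_X, eq_comm] at h0
  simp only [mul_eq_zero, pow_eq_zero_iff', PowerSeries.X_ne_zero, false_and, false_or] at h0
  rw [← constantCoeff_diag, h0, map_zero] at hu0
  exact hu0 rfl

include hσ0 hσ in
/-- If `τ = σ`, then `B` has dimension three: the power series that vanish on the diagonal `x = y`
form a prime ideal of `B` strictly between `(x - y)` and the maximal ideal. -/
theorem ringKrullDim_B_self_eq_three : ringKrullDim (B σ σ) = 3 := by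
  have hB := isLocalEdgeClosed_B σ σ
  have := uniqueFactorizationMonoid_B hσ0 hσ0 hσ hσ
  refine le_antisymm (ringKrullDim_B_le_three hσ0 hσ0 hσ) ?_
  have hxy : Prime (hB.var 0 - hB.var 1) := by
    rw [← UniqueFactorizationMonoid.irreducible_iff_prime]
    refine ⟨?_, fun a b hab => ?_⟩
    · rw [hB.isUnit_iff, not_not]
      simp [IsEdgeClosed.coe_var]
    -- a product of two nonunits has no linear terms
    · by_contra! h
      rw [hB.isUnit_iff, hB.isUnit_iff, not_not, not_not] at h
      have h2 := mul_mem_orderIdeal (mem_orderIdeal_one.2 h.1) (mem_orderIdeal_one.2 h.2)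
      rw [← Subalgebra.coe_mul, ← hab, AddSubgroupClass.coe_sub, hB.coe_var, hB.coe_var] at h2
      have h3 := mem_orderIdeal.1 h2 (Finsupp.single 0 1) (by simp)
      classical
      simp [MvPowerSeries.coeff_X, Finsupp.single_left_inj] at h3
  let Q : Ideal (B σ σ) := RingHom.ker ((diag (k := k)).toRingHom.comp (B σ σ).val.toRingHom)
  have hmemQ : ∀ f : B σ σ, f ∈ Q ↔ diag (f : PS k) = 0 := fun f => Iff.rfl
  let a : PrimeSpectrum (B σ σ) := ⟨⊥, Ideal.isPrime_bot⟩
  let b : PrimeSpectrum (B σ σ) := ⟨Ideal.span {hB.var 0 - hB.var 1},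
    (Ideal.span_singleton_prime hxy.ne_zero).2 hxy⟩
  let c : PrimeSpectrum (B σ σ) := ⟨Q, RingHom.ker_isPrime _⟩
  let d : PrimeSpectrum (B σ σ) := ⟨Ideal.span {hB.var 0, hB.var 1}, hB.span_isPrime⟩
  have hab : a < b := by
    rw [← PrimeSpectrum.asIdeal_lt_asIdeal, bot_lt_iff_ne_bot, Ne, Ideal.span_singleton_eq_bot]
    exact hxy.ne_zero
  have hbc : b < c := by
    rw [← PrimeSpectrum.asIdeal_lt_asIdeal]
    refine lt_of_le_of_ne ?_ fun h => ?_
    · rw [Ideal.span_singleton_le_iff_mem, hmemQ, AddSubgroupClass.coe_sub, map_sub, hB.coe_var,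
        hB.coe_var, diag_X, diag_X, sub_self]
    · have : (⟨inVar 0 σ, inVar_mem_B hσ0 0⟩ - ⟨inVar 1 σ, inVar_mem_B hσ0 1⟩ : B σ σ) ∈
          c.asIdeal := by
        rw [hmemQ, AddSubgroupClass.coe_sub, map_sub, diag_inVar, diag_inVar, sub_self]
      rw [← h] at this
      exact not_sub_dvd_sub hσ0 hσ (Ideal.mem_span_singleton.1 this)
  have hcd : c < d := by
    rw [← PrimeSpectrum.asIdeal_lt_asIdeal]
    refine lt_of_le_of_ne (fun f hf => ?_) fun h => ?_
    · rw [hB.mem_span_iff, ← constantCoeff_diag, (hmemQ f).1 hf, map_zero]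
    · have : hB.var 0 ∈ d.asIdeal := Ideal.subset_span (by simp)
      rw [← h, hmemQ, hB.coe_var, diag_X] at this
      exact PowerSeries.X_ne_zero this
  exact Order.le_krullDim_iff.2 ⟨⟨3, ![a, b, c, d], fun i => by
    fin_cases i
    exacts [hab, hbc, hcd]⟩, rfl⟩

end

end

/-! ### Dimension two -/

section

variable {k : Type*} [Field k]

/-- For a transcendental power series `σ`, the order of vanishing of `Q(x, σ)` is bounded in terms
of the degree of the nonzero polynomial `Q`: the polynomials of bounded degree form a
finite-dimensional space, and its subspaces of polynomials with `X ^ n ∣ Q(x, σ)` decrease to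
zero. -/
theorem exists_forall_not_X_pow_dvd_aevalX {σ : PowerSeries k}
    (hσ : Transcendental (Polynomial k) σ) (D : ℕ) :
    ∃ n, ∀ Q : MvPolynomial (Fin 2) k, Q.totalDegree ≤ D → Q ≠ 0 →
      ¬ (PowerSeries.X : PowerSeries k) ^ n ∣ aevalX σ Q := by
  let V := MvPolynomial.restrictTotalDegree (Fin 2) k D
  let W : ℕ → Submodule k V := fun n =>
    ((Ideal.span {(PowerSeries.X : PowerSeries k) ^ n}).restrictScalars k).comap
      ((aevalX σ).toLinearMap ∘ₗ V.subtype)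
  have hW : ∀ n (Q : V), Q ∈ W n ↔ (PowerSeries.X : PowerSeries k) ^ n ∣ aevalX σ Q := fun n Q =>
    Ideal.mem_span_singleton
  have hanti : Antitone W := fun m n h Q hQ => by
    rw [hW] at hQ ⊢
    exact (pow_dvd_pow _ h).trans hQ
  obtain ⟨n, hn⟩ := IsArtinian.monotone_stabilizes (⟨fun n => OrderDual.toDual (W n), hanti⟩ :
    ℕ →o (Submodule k V)ᵒᵈ)
  refine ⟨n, fun Q hQ hQ0 hdvd => hQ0 (aevalX_injective hσ ?_)⟩
  have hmem : (⟨Q, (MvPolynomial.mem_restrictTotalDegree _ _ _).2 hQ⟩ : V) ∈ W n := (hW _ _).2 hdvd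
  rw [map_zero]
  ext j
  have h2 : (⟨Q, (MvPolynomial.mem_restrictTotalDegree _ _ _).2 hQ⟩ : V) ∈ W (max n (j + 1)) := by
    have h3 : W n = W (max n (j + 1)) := hn _ (le_max_left _ _)
    rwa [← h3]
  exact PowerSeries.X_pow_dvd_iff.1 ((hW _ _).1 h2) j (lt_max_of_lt_right j.lt_succ_self)

theorem totalDegree_resultant_le {ι R : Type*} [CommRing R] (F G : Polynomial (MvPolynomial ι R))
    (d m n : ℕ) (hF : ∀ i, (F.coeff i).totalDegree ≤ d) (hG : ∀ i, (G.coeff i).totalDegree ≤ d) :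
    (F.resultant G m n).totalDegree ≤ (m + n) * d := by
  rw [Polynomial.resultant, Matrix.det_apply]
  refine MvPolynomial.totalDegree_finsetSum_le fun s _ => ?_
  have hz : ∀ (u : ℤˣ) (p : MvPolynomial ι R), (u • p).totalDegree ≤ p.totalDegree := fun u p => by
    rcases Int.units_eq_one_or u with rfl | rfl <;> simp
  refine (hz _ _).trans ((MvPolynomial.totalDegree_finsetProd _ _).trans ?_)
  refine (Finset.sum_le_card_nsmul _ _ d fun i _ => ?_).trans (by simp)
  rw [Polynomial.sylvester, Matrix.of_apply]
  induction i using Fin.addCases <;>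
  · simp only [Fin.addCases_left, Fin.addCases_right]
    split_ifs
    exacts [by first | exact hF _ | exact hG _, by simp]

/-- By Gauss's lemma, an irreducible polynomial remains irreducible over the field of fractions. -/
theorem resultant_ne_zero_of_irreducible {R : Type*} [CommRing R] [IsDomain R] [IsGCDMonoid R]
    {F G : Polynomial R} (hF : Irreducible F) (hdeg : F.natDegree ≠ 0) (h : ¬ F ∣ G) :
    F.resultant G ≠ 0 := by
  let K := FractionRing R
  have hinj := FaithfulSMul.algebraMap_injective R K
  have hprim := hF.isPrimitive hdeg
  have hirr := (hprim.irreducible_iff_irreducible_map_fraction_map (K := K)).1 hF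
  intro h0
  have h1 : (F.map (algebraMap R K)).resultant (G.map (algebraMap R K)) = 0 := by
    rw [Polynomial.natDegree_map_eq_of_injective hinj,
      Polynomial.natDegree_map_eq_of_injective hinj, Polynomial.resultant_map_map, h0, map_zero]
  refine (Polynomial.resultant_eq_zero_iff.1 h1).2 ?_
  exact (hirr.coprime_iff_not_dvd).2 fun h2 => h (hprim.dvd_of_fraction_map_dvd_fraction_map h2)

theorem totalDegree_coeff_comp_map_C_le {ι R : Type*} [CommRing R]
    (G : Polynomial (MvPolynomial ι R)) (T : Polynomial R) (d : ℕ)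
    (hG : ∀ i, (G.coeff i).totalDegree ≤ d) (j : ℕ) :
    ((G.comp (T.map MvPolynomial.C)).coeff j).totalDegree ≤ d := by
  rw [Polynomial.comp_eq_sum_left, Polynomial.sum_def, Polynomial.finsetSum_coeff]
  refine MvPolynomial.totalDegree_finsetSum_le fun i _ => ?_
  rw [← Polynomial.map_pow, Polynomial.coeff_C_mul, Polynomial.coeff_map]
  exact (MvPolynomial.totalDegree_mul _ _).trans (by simpa using hG i)

variable {σ τ : PowerSeries k}
  (hσ0 : PowerSeries.constantCoeff σ = 0) (hτ0 : PowerSeries.constantCoeff τ = 0)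

/-- Evaluation of polynomials in one variable over `k[x, σ]` at `y` (for `i = 0`) or at `τ` (for
`i = 1`). -/
def evalB₁ (i : Fin 2) : Polynomial (MvPolynomial (Fin 2) k) →+* B σ τ :=
  Polynomial.eval₂RingHom ((evalB hσ0 hτ0).comp MvPolynomial.C) (evalB hσ0 hτ0 (MvPolynomial.X i))

theorem evalB₁_C (i : Fin 2) (r : MvPolynomial (Fin 2) k) :
    evalB₁ hσ0 hτ0 i (Polynomial.C r) = evalB hσ0 hτ0 (MvPolynomial.C r) :=
  Polynomial.eval₂_C _ _

theorem evalB₁_X (i : Fin 2) :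
    evalB₁ hσ0 hτ0 i Polynomial.X = evalB hσ0 hτ0 (MvPolynomial.X i) :=
  Polynomial.eval₂_X _ _

/-- If `P` contains no nonzero polynomial in `y` over `k[x, σ]`, then only the variable `τ`
contributes to its height; likewise with `y` and `τ` exchanged. -/
theorem height_le_one_of_forall_evalB₁_notMem (P : Ideal (B σ τ)) (hP : P.IsPrime)
    (hx : (isLocalEdgeClosed_B σ τ).var 0 ∉ P) (hy : (isLocalEdgeClosed_B σ τ).var 1 ∉ P)
    (i : Fin 2) (h : ∀ F, F ≠ 0 → evalB₁ hσ0 hτ0 i F ∉ P) : P.height ≤ 1 := by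
  obtain ⟨j, hij⟩ : ∃ j : Fin 2, i ≠ j := ⟨i + 1, by omega⟩
  let ψ : MvPolynomial (Fin 1) (Polynomial (MvPolynomial (Fin 2) k)) →+* B σ τ :=
    MvPolynomial.eval₂Hom (evalB₁ hσ0 hτ0 i) fun _ => evalB hσ0 hτ0 (MvPolynomial.X j)
  let ι : Poly4 k →+* MvPolynomial (Fin 1) (Polynomial (MvPolynomial (Fin 2) k)) :=
    MvPolynomial.eval₂Hom (MvPolynomial.C.comp Polynomial.C) fun l =>
      if l = i then MvPolynomial.C Polynomial.X else MvPolynomial.X 0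
  have hψι : ∀ p, ψ (ι p) = evalB hσ0 hτ0 p := fun p => by
    suffices ψ.comp ι = evalB hσ0 hτ0 from congr($this p)
    refine MvPolynomial.ringHom_ext (fun r => ?_) fun l => ?_
    · simp only [ψ, ι, RingHom.comp_apply, MvPolynomial.coe_eval₂Hom, MvPolynomial.eval₂_C]
      exact evalB₁_C hσ0 hτ0 i r
    · by_cases hl : l = i
      · subst hl
        simp only [ψ, ι, RingHom.comp_apply, MvPolynomial.coe_eval₂Hom, MvPolynomial.eval₂_X,
          if_true, MvPolynomial.eval₂_C]
        exact evalB₁_X hσ0 hτ0 l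
      · have : l = j := by omega
        subst this
        simp [ψ, ι, hl]
  rw [← Nat.cast_one]
  refine height_le_of_height_comap_le
    (T := MvPolynomial (Fin 1) (Polynomial (MvPolynomial (Fin 2) k))) ψ 1 P (fun b => ?_) ?_
  · obtain ⟨s, t, hs, ht⟩ := exists_evalB_notMem hσ0 hτ0 P hP hx hy b
    exact ⟨ι s, ι t, by rwa [hψι], by rw [hψι, hψι, ht]⟩
  · refine height_le_of_comap_C_eq_bot _ fun r hr => ?_
    rw [Ideal.mem_comap, MvPolynomial.coe_eval₂Hom, MvPolynomial.eval₂_C]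
    exact h r hr

end

section

/-- A nonzero polynomial takes values in a prime ideal `P` at only finitely many points of a
sequence that is injective modulo `P`, if its coefficients are taken from a ring that meets `P`
trivially. -/
theorem finite_setOf_eval₂_mem {R S : Type*} [CommRing R] [CommRing S] (P : Ideal S)
    (hP : P.IsPrime) (c : R →+* S) (hc : ∀ r, r ≠ 0 → c r ∉ P) {t : ℕ → S}
    (ht : ∀ m n, m ≠ n → t m - t n ∉ P) {G : Polynomial R} (hG : G ≠ 0) :
    {n | G.eval₂ c (t n) ∈ P}.Finite := by
  let q : R →+* S ⧸ P := (Ideal.Quotient.mk P).comp c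
  have hq : Function.Injective q := by
    rw [injective_iff_map_eq_zero]
    intro r hr
    by_contra hr0
    exact hc r hr0 (Ideal.Quotient.eq_zero_iff_mem.1 hr)
  have ht' : Function.Injective fun n => Ideal.Quotient.mk P (t n) := fun m n h => by
    by_contra hmn
    exact ht m n hmn (Ideal.Quotient.eq.1 h)
  have hfin := Polynomial.finite_setOfPred_isRoot ((Polynomial.map_ne_zero_iff hq).2 hG)
  refine (hfin.preimage ht'.injOn).subset fun n hn => ?_
  rw [Set.mem_preimage, Set.mem_ofPred_eq, Polynomial.IsRoot, Polynomial.eval_map,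
    ← Polynomial.hom_eval₂]
  exact Ideal.Quotient.eq_zero_iff_mem.2 hn

namespace IsLocalEdgeClosed

variable {k : Type*} [Field k] {S : Subalgebra k (PS k)} (hS : IsLocalEdgeClosed S)

include hS

/-- Modulo a nonzero prime `P` that does not contain `X i`, a power of `X j` is a multiple of `X i`:
an element of `P` that is not divisible by `X i` restricts to a power of `X j` times a unit on the
`j`-th axis. -/
theorem exists_var_pow_sub_mem {P : Ideal S} (hP : P.IsPrime) (hP0 : P ≠ ⊥) {i j : Fin 2}
    (hij : i ≠ j) (hi : hS.var i ∉ P) : ∃ m c, hS.var j ^ m - hS.var i * c ∈ P := by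
  obtain ⟨f, hf, hf0⟩ := P.ne_bot_iff.1 hP0
  obtain ⟨n, g, rfl, hg⟩ := hS.exists_eq_var_pow_mul i hf0
  have hgP : g ∈ P := (hP.mem_or_mem hf).resolve_left fun h => hi (hP.mem_of_pow_mem n h)
  obtain ⟨w, hw⟩ := hS.exists_eq_inVar_edge_add hij g
  have hedge : edge j (g : PS k) ≠ 0 := fun h =>
    hg ((hS.var_dvd_iff i g).2 ((X_dvd_iff_edge hij _).2 h))
  obtain ⟨m, u, hu, hu0⟩ := hS.toIsEdgeClosed.exists_inVar_eq hedge (hS.inVar_edge_mem j g.2)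
  have e : g = hS.var j ^ m * u + hS.var i * w := Subtype.ext (by rw [hw, hu]; rfl)
  obtain ⟨v, hv⟩ := ((hS.isUnit_iff u).2 hu0).exists_right_inv
  refine ⟨m, -(w * v), ?_⟩
  have : hS.var j ^ m - hS.var i * -(w * v) = v * g := by
    rw [e]
    linear_combination (-hS.var j ^ m) * hv
  rw [this]
  exact P.mul_mem_left _ hgP

/-- If `X j ^ m` is a multiple of `X i` modulo `P`, then a high power of `X j` cannot cancel a low
power of `X i` modulo `P`. -/
theorem var_pow_mul_add_notMem {P : Ideal S} (hP : P.IsPrime) {i j : Fin 2} (hi : hS.var i ∉ P)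
    {m : ℕ} {c : S} (h : hS.var j ^ m - hS.var i * c ∈ P) {a M : ℕ} (hM : m * (a + 1) ≤ M) {u : S}
    (hu : MvPowerSeries.constantCoeff (u : PS k) ≠ 0) (b : S) :
    hS.var i ^ a * u + hS.var j ^ M * b ∉ P := by
  intro hmem
  obtain ⟨l, rfl⟩ := Nat.exists_eq_add_of_le hM
  have h1 : hS.var j ^ (m * (a + 1)) - hS.var i ^ (a + 1) * c ^ (a + 1) ∈ P := by
    rw [pow_mul, ← mul_pow]
    exact P.mem_of_dvd (sub_dvd_pow_sub_pow _ _ _) h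
  have h2 : hS.var i ^ a * (u + hS.var i * (c ^ (a + 1) * hS.var j ^ l * b)) ∈ P := by
    convert sub_mem hmem (P.mul_mem_right (hS.var j ^ l * b) h1) using 1
    ring
  refine hi (hP.mem_of_pow_mem a (hS.mem_of_mul_mem_of_constantCoeff_ne_zero ?_ h2))
  simpa [IsEdgeClosed.coe_var] using hu

end IsLocalEdgeClosed

variable {k : Type*} [Field k] {σ τ : PowerSeries k}
  (hσ0 : PowerSeries.constantCoeff σ = 0) (hτ0 : PowerSeries.constantCoeff τ = 0)

theorem coe_evalB₁_zero_map_C (T : Polynomial k) :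
    (evalB₁ hσ0 hτ0 0 (T.map MvPolynomial.C) : PS k) = inVar 1 (T : PowerSeries k) := by
  induction T using Polynomial.induction_on' with
  | add p q hp hq =>
    rw [Polynomial.map_add, map_add, Subalgebra.coe_add, hp, hq, Polynomial.coe_add, inVar_add]
  | monomial n a =>
    rw [← Polynomial.C_mul_X_pow_eq_monomial, Polynomial.map_mul, Polynomial.map_pow,
      Polynomial.map_C, Polynomial.map_X, map_mul, map_pow, evalB₁_C, evalB₁_X, Subalgebra.coe_mul,
      Subalgebra.coe_pow, coe_evalB, coe_evalB, evalPoly4_C, ← MvPolynomial.algebraMap_eq,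
      AlgHom.commutes, inVar_algebraMap, Polynomial.coe_mul, Polynomial.coe_pow, Polynomial.coe_C,
      Polynomial.coe_X, ← inVarHom_apply, map_mul, map_pow, inVarHom_apply, inVarHom_apply, inVar_X,
      ← inVar_algebraMap 1]
    simp [evalPoly4]

theorem evalB₁_zero_comp (G : Polynomial (MvPolynomial (Fin 2) k)) (T : Polynomial k) :
    evalB₁ hσ0 hτ0 0 (G.comp (T.map MvPolynomial.C)) =
      G.eval₂ ((evalB hσ0 hτ0).comp MvPolynomial.C) (evalB₁ hσ0 hτ0 0 (T.map MvPolynomial.C)) := by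
  rw [Polynomial.comp, Polynomial.hom_eval₂]
  congr 1
  exact RingHom.ext fun r => evalB₁_C hσ0 hτ0 0 r

theorem var_pow_dvd_evalB₁_sub {T : Polynomial k} {M : ℕ}
    (hT : (PowerSeries.X : PowerSeries k) ^ M ∣ τ - T) (G : Polynomial (MvPolynomial (Fin 2) k)) :
    (isLocalEdgeClosed_B σ τ).var 1 ^ M ∣
      evalB₁ hσ0 hτ0 1 G - evalB₁ hσ0 hτ0 0 (G.comp (T.map MvPolynomial.C)) := by
  rw [evalB₁_zero_comp, evalB₁, Polynomial.coe_eval₂RingHom, Polynomial.eval₂_eq_eval_map,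
    Polynomial.eval₂_eq_eval_map]
  refine Dvd.dvd.trans ?_ (Polynomial.sub_dvd_eval_sub _ _ _)
  obtain ⟨w, hw⟩ := hT
  have e : ((evalB hσ0 hτ0 (MvPolynomial.X 1) - evalB₁ hσ0 hτ0 0 (T.map MvPolynomial.C) : B σ τ) :
      PS k) = MvPowerSeries.X 1 ^ M * inVar 1 w := by
    rw [AddSubgroupClass.coe_sub, coe_evalB₁_zero_map_C, coe_evalB, ← inVar_X, ← inVarHom_apply,
      ← inVarHom_apply, ← inVarHom_apply, ← map_pow, ← map_mul, ← hw, map_sub]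
    simp [evalPoly4, inVarHom_apply]
  exact ⟨⟨inVar 1 w, (isLocalEdgeClosed_B σ τ).of_X_pow_mul_mem 1 M (e ▸ Subtype.property _)⟩,
    Subtype.ext e⟩

theorem finite_setOf_evalB₁_comp_mem (hσ : Transcendental (Polynomial k) σ) (P : Ideal (B σ τ))
    (hP : P.IsPrime) (hx : (isLocalEdgeClosed_B σ τ).var 0 ∉ P)
    (hy : (isLocalEdgeClosed_B σ τ).var 1 ∉ P) {T : ℕ → Polynomial k} (hT : Function.Injective T)
    {G : Polynomial (MvPolynomial (Fin 2) k)} (hG : G ≠ 0) :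
    {n | evalB₁ hσ0 hτ0 0 (G.comp ((T n).map MvPolynomial.C)) ∈ P}.Finite := by
  simp only [evalB₁_zero_comp]
  refine finite_setOf_eval₂_mem P hP _
    (fun r hr => evalB_C_notMem hσ0 hτ0 hσ P hP hx hr) (fun m n hmn => ?_) hG
  refine (isLocalEdgeClosed_B σ τ).notMem_of_eq_inVar hP hy
    (g := ((T m - T n : Polynomial k) : PowerSeries k)) ?_ ?_
  · rw [Ne, Polynomial.coe_eq_zero_iff, sub_eq_zero]
    exact fun h => hmn (hT h)
  · rw [← coe_evalB₁_zero_map_C hσ0 hτ0, Polynomial.map_sub, map_sub]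

include hσ0 hτ0 in
/-- If the partial sums of `τ` converge to `τ` fast enough compared with the orders of vanishing of
polynomials in `x` and `σ`, then the primes of `B` that contain no variable have height at most one.
If the height were larger, such a prime `P` would contain nonzero `F(y)` and `G(τ)` with
coefficients in `k[x, σ]`. The resultant of `F` and `G(τ_n)`, for a partial sum `τ_n` of `τ`, is a
polynomial in `x` and `σ` that belongs to `P` up to a multiple of a high power of `y`, whereas its
order in `x` is small. -/
theorem height_le_one_of_lacunary (hσ : Transcendental (Polynomial k) σ) {M : ℕ → ℕ}
    (hM : StrictMono M) (hM0 : 0 < M 0) (hτM : τ = lacunary k M) {φ : ℕ → ℕ}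
    (hφ : ∀ D, ∀ Q : MvPolynomial (Fin 2) k, Q.totalDegree ≤ D → Q ≠ 0 →
      ¬ (PowerSeries.X : PowerSeries k) ^ φ D ∣ aevalX σ Q)
    (hgap : ∀ n, ∀ m ≤ n, ∀ D ≤ n * M n, m * φ D ≤ M (n + 1))
    (P : Ideal (B σ τ)) (hP : P.IsPrime) (hx : (isLocalEdgeClosed_B σ τ).var 0 ∉ P)
    (hy : (isLocalEdgeClosed_B σ τ).var 1 ∉ P) : P.height ≤ 1 := by
  by_contra hht
  have hB := isLocalEdgeClosed_B σ τ
  have hex : ∀ i, ∃ F, F ≠ 0 ∧ evalB₁ hσ0 hτ0 i F ∈ P := fun i => by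
    by_contra! h
    exact hht (height_le_one_of_forall_evalB₁_notMem hσ0 hτ0 P hP hx hy i h)
  obtain ⟨F, hFP, hF⟩ : ∃ F, evalB₁ hσ0 hτ0 0 F ∈ P ∧ Prime F := by
    obtain ⟨F, hF0, hFP⟩ := hex 0
    exact (hP.comap (evalB₁ hσ0 hτ0 0)).exists_mem_prime_of_ne_bot
      (Submodule.ne_bot_iff _ |>.2 ⟨F, hFP, hF0⟩)
  obtain ⟨G, hG0, hGP⟩ := hex 1
  have hFdeg : F.natDegree ≠ 0 := fun h => by
    rw [Polynomial.eq_C_of_natDegree_eq_zero h, evalB₁_C] at hFP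
    refine evalB_C_notMem hσ0 hτ0 hσ P hP hx (fun h0 => hF.ne_zero ?_) hFP
    rw [Polynomial.eq_C_of_natDegree_eq_zero h, h0, map_zero]
  obtain ⟨m, c, hmc⟩ := hB.exists_var_pow_sub_mem hP
    (fun h => hht (by rw [h, Ideal.height_bot]; simp)) zero_ne_one hx
  obtain ⟨d, hFd, hGd⟩ : ∃ d, (∀ i, (F.coeff i).totalDegree ≤ d) ∧
      ∀ i, (G.coeff i).totalDegree ≤ d := by
    have hsup : ∀ (H : Polynomial (MvPolynomial (Fin 2) k)) i,
        (H.coeff i).totalDegree ≤ H.support.sup fun i => (H.coeff i).totalDegree := fun H i => by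
      by_cases hi : H.coeff i = 0
      · simp [hi]
      · exact Finset.le_sup (f := fun i => (H.coeff i).totalDegree)
          (Polynomial.mem_support_iff.2 hi)
    exact ⟨_, fun i => (hsup F i).trans (le_max_left _ _),
      fun i => (hsup G i).trans (le_max_right _ _)⟩
  -- all but finitely many partial sums of `τ` are suitable; take a late one
  obtain ⟨n, hn, hnP⟩ : ∃ n, max m ((F.natDegree + G.natDegree) * d) ≤ n ∧
      evalB₁ hσ0 hτ0 0 (G.comp ((lacunarySum k M n).map MvPolynomial.C)) ∉ P := by
    by_contra! h
    exact (Set.Ici_infinite _) ((finite_setOf_evalB₁_comp_mem hσ0 hτ0 hσ P hP hx hy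
      (lacunarySum_injective hM) hG0).subset fun n hn => h n hn)
  set Gn := G.comp ((lacunarySum k M n).map MvPolynomial.C) with hGn
  have hres0 : F.resultant Gn ≠ 0 := resultant_ne_zero_of_irreducible hF.irreducible hFdeg fun h =>
    hnP (P.mem_of_dvd (map_dvd (evalB₁ hσ0 hτ0 0) h) hFP)
  have hGndeg : Gn.natDegree ≤ G.natDegree * M n := Polynomial.natDegree_comp_le.trans
    (Nat.mul_le_mul_left _ (Polynomial.natDegree_map_le.trans (natDegree_lacunarySum_le hM n)))
  have hresdeg : (F.resultant Gn).totalDegree ≤ n * M n := by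
    have hpos : 1 ≤ M n := hM0.trans_le (hM.monotone n.zero_le)
    refine (totalDegree_resultant_le F Gn d _ _ hFd
      (totalDegree_coeff_comp_map_C_le G _ d hGd)).trans ?_
    calc (F.natDegree + Gn.natDegree) * d
        ≤ (F.natDegree * M n + G.natDegree * M n) * d := by
          gcongr
          exact Nat.le_mul_of_pos_right _ hpos
      _ = (F.natDegree + G.natDegree) * d * M n := by ring
      _ ≤ n * M n := Nat.mul_le_mul_right _ ((le_max_right _ _).trans hn)
  obtain ⟨p, q, -, -, hpq⟩ := Polynomial.exists_mul_add_mul_eq_C_resultant F Gn le_rfl le_rfl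
    (.inl hFdeg)
  obtain ⟨b, hb⟩ := var_pow_dvd_evalB₁_sub hσ0 hτ0
    (hτM ▸ X_pow_dvd_lacunary_sub hM n) G
  -- the resultant is `x ^ a` times a unit, with `a < φ D` for its degree `D`
  have hr := evalPoly4_C σ τ (F.resultant Gn)
  have hr0 := (map_ne_zero_iff _ (aevalX_injective hσ)).2 hres0
  obtain ⟨a, u, hu, hu0⟩ := hB.toIsEdgeClosed.exists_inVar_eq (j := 0) hr0
    (hr ▸ (evalB hσ0 hτ0 (MvPolynomial.C (F.resultant Gn))).2)
  have ha : a + 1 ≤ φ (F.resultant Gn).totalDegree := by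
    by_contra! hlt
    refine hφ _ _ le_rfl hres0 ((pow_dvd_pow _ (Nat.lt_succ_iff.1 hlt)).trans ?_)
    refine ⟨edge 0 (u : PS k), ?_⟩
    rw [← edge_inVar_self 0 (aevalX σ _), hu, map_mul, map_pow, edge_X_self]
  have e : evalB hσ0 hτ0 (MvPolynomial.C (F.resultant Gn)) = hB.var 0 ^ a * u :=
    Subtype.ext (hr.trans hu)
  refine hB.var_pow_mul_add_notMem hP hx hmc
    ((Nat.mul_le_mul_left m ha).trans (hgap n m ((le_max_left _ _).trans hn) _ hresdeg)) hu0
    (b * evalB₁ hσ0 hτ0 0 q) ?_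
  rw [← e, ← mul_assoc, ← hb, ← evalB₁_C hσ0 hτ0 0, ← hpq, map_add, map_mul, map_mul]
  convert add_mem (P.mul_mem_right (evalB₁ hσ0 hτ0 0 p) hFP)
    (P.mul_mem_right (evalB₁ hσ0 hτ0 0 q) hGP) using 1
  rw [hGn]
  ring

/-- Here `σ` may be any transcendental series, and `τ` is a lacunary series with gaps so large,
depending on `σ`, that `height_le_one_of_lacunary` applies. -/
theorem exists_ringKrullDim_B_eq_two (k : Type*) [Field k] :
    ∃ σ τ : PowerSeries k, IsTranscendentalPair σ τ ∧ ringKrullDim (B σ τ) = 2 := by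
  obtain ⟨σ, hσ0, hσ⟩ := exists_transcendental k
  choose φ hφ using exists_forall_not_X_pow_dvd_aevalX hσ
  -- the first summand makes `τ` transcendental, and the sum over `D` makes its gaps large compared
  -- with `φ D` for all degrees `D` of resultants that occur
  let M : ℕ → ℕ := Nat.rec 1 fun n Mn =>
    (n + 1) * Mn + 1 + n * ∑ D ∈ Finset.range (n * Mn + 1), φ D
  have hsucc : ∀ n, M (n + 1) =
      (n + 1) * M n + 1 + n * ∑ D ∈ Finset.range (n * M n + 1), φ D := fun _ => rfl
  have hM : StrictMono M := strictMono_nat_of_lt_succ fun n => by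
    rw [hsucc]
    nlinarith [Nat.zero_le (n * M n), Nat.zero_le (n * ∑ D ∈ Finset.range (n * M n + 1), φ D)]
  have hM0 : 0 < M 0 := one_pos
  have hτ0 := constantCoeff_lacunary (k := k) hM hM0
  have hτ : Transcendental (Polynomial k) (lacunary k M) :=
      transcendental_lacunary hM hM0 fun n => by
    rw [hsucc]
    nlinarith [Nat.zero_le (M n), Nat.zero_le (n * ∑ D ∈ Finset.range (n * M n + 1), φ D)]
  have hgap : ∀ n, ∀ m ≤ n, ∀ D ≤ n * M n, m * φ D ≤ M (n + 1) := fun n m hm D hD => by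
    rw [hsucc]
    refine le_add_left (Nat.mul_le_mul hm ?_)
    exact Finset.single_le_sum_of_canonicallyOrdered (f := φ) (by simpa using Nat.lt_succ_iff.2 hD)
  have hB := isLocalEdgeClosed_B σ (lacunary k M)
  refine ⟨σ, lacunary k M, isTranscendentalPair_of_transcendental hσ0 hτ0 hσ hτ,
    le_antisymm ?_ hB.two_le_ringKrullDim⟩
  refine (hB.ringKrullDim_le le_rfl fun P hP hx hy => ?_).trans (by norm_num)
  rw [Nat.cast_one]
  exact height_le_one_of_lacunary hσ0 hτ0 hσ hM hM0 rfl hφ hgap P hP hx hy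

end

end TwoVar

end

theorem theorem4p2 (k : Type*) [Field k] :
    (∀ σ τ : PowerSeries k, TwoVar.IsTranscendentalPair σ τ →
      -- `A` is a two-dimensional regular local ring that birationally dominates `B`
      (IsRegularLocalRing (TwoVar.A σ τ) ∧ ringKrullDim (TwoVar.A σ τ) = 2 ∧
        TwoVar.BirationallyDominates (TwoVar.A σ τ) (TwoVar.B σ τ)) ∧
      -- the maximal ideal of `A` is `(x, y)A`, and the completion of `A` is `k[[x, y]]`
      (∃ _ : IsLocalRing (TwoVar.A σ τ),
        IsLocalRing.maximalIdeal (TwoVar.A σ τ) = TwoVar.idealA σ τ ∧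
        Nonempty (AdicCompletion (IsLocalRing.maximalIdeal (TwoVar.A σ τ)) (TwoVar.A σ τ)
          ≃ₐ[TwoVar.A σ τ] MvPowerSeries (Fin 2) k)) ∧
      -- `U` and `B` are unique factorization domains
      (UniqueFactorizationMonoid (TwoVar.U σ τ) ∧ UniqueFactorizationMonoid (TwoVar.B σ τ)) ∧
      -- `B` is a local Krull domain with maximal ideal `(x, y)B`
      (TwoVar.IsKrullDomain (TwoVar.B σ τ) ∧
        ∃ _ : IsLocalRing (TwoVar.B σ τ),
          IsLocalRing.maximalIdeal (TwoVar.B σ τ) = TwoVar.idealB σ τ) ∧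
      -- the dimension of `B` is 2 or 3
      (ringKrullDim (TwoVar.B σ τ) = 2 ∨ ringKrullDim (TwoVar.B σ τ) = 3) ∧
      -- `B` is Hausdorff, and its completion is canonically `k[[x, y]]`
      @T2Space (TwoVar.B σ τ) (TwoVar.idealB σ τ).adicTopology ∧
      Nonempty (AdicCompletion (TwoVar.idealB σ τ) (TwoVar.B σ τ)
        ≃ₐ[TwoVar.B σ τ] MvPowerSeries (Fin 2) k) ∧
      [ TwoVar.B σ τ = TwoVar.A σ τ,
        IsRegularLocalRing (TwoVar.B σ τ) ∧ ringKrullDim (TwoVar.B σ τ) = 2,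
        IsNoetherianRing (TwoVar.B σ τ),
        ∀ I : Ideal (TwoVar.B σ τ), I.FG →
          @IsClosed _ (TwoVar.idealB σ τ).adicTopology (I : Set (TwoVar.B σ τ)),
        ∀ b : TwoVar.B σ τ,
          @IsClosed _ (TwoVar.idealB σ τ).adicTopology
            (Ideal.span {b} : Set (TwoVar.B σ τ)) ].TFAE) ∧
    -- both dimensions occur, depending on the choice of `σ` and `τ`
    (∃ σ τ : PowerSeries k, TwoVar.IsTranscendentalPair σ τ ∧ ringKrullDim (TwoVar.B σ τ) = 2) ∧
    (∃ σ τ : PowerSeries k, TwoVar.IsTranscendentalPair σ τ ∧ ringKrullDim (TwoVar.B σ τ) = 3) := by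
  refine ⟨fun σ τ h => ?_, TwoVar.exists_ringKrullDim_B_eq_two k, ?_⟩
  · have hσ0 := h.constantCoeff_left
    have hτ0 := h.constantCoeff_right
    have hσ := (TwoVar.transcendental_coe_laurentSeries_iff σ).1 h.transcendental_left
    have hτ := (TwoVar.transcendental_coe_laurentSeries_iff τ).1 h.transcendental_right
    have hA := TwoVar.isLocalEdgeClosed_A hσ0 hτ0
    have hB := TwoVar.isLocalEdgeClosed_B σ τ
    have := TwoVar.isNoetherianRing_A hσ0 hτ0
    have := hA.isLocalRing
    have := hB.isLocalRing
    have := TwoVar.uniqueFactorizationMonoid_B hσ0 hτ0 hσ hτ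
    refine ⟨⟨hA.isRegularLocalRing, hA.ringKrullDim_eq_two,
      TwoVar.birationallyDominates hσ0 hτ0⟩, ⟨hA.isLocalRing, hA.maximalIdeal_eq, ?_⟩,
      ⟨TwoVar.uniqueFactorizationMonoid_U hσ0 hτ0 hσ hτ, this⟩,
      ⟨TwoVar.isKrullDomain_of_uniqueFactorizationMonoid, hB.isLocalRing, hB.maximalIdeal_eq⟩,
      TwoVar.ringKrullDim_B_eq_two_or_three hσ0 hτ0 hσ, TwoVar.t2Space_adicTopology_B,
      hB.nonempty_adicCompletion_equiv, TwoVar.tfae_B_eq_A hσ0 hτ0⟩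
    rw [hA.maximalIdeal_eq]
    exact hA.nonempty_adicCompletion_equiv
  · obtain ⟨σ, hσ0, hσ⟩ := TwoVar.exists_transcendental k
    exact ⟨σ, σ, TwoVar.isTranscendentalPair_of_transcendental hσ0 hσ0 hσ hσ,
      TwoVar.ringKrullDim_B_self_eq_three hσ0 hσ⟩
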